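/- Let $\mathrm{Cat}$ be the 2-category of small categories and let $\Delta_2$ be the full subcategory of the simplex category $\Delta$ on the objects $[0],[1],[2]$, regarded as a locally discrete 2-category. Let $W_l:\Delta_2\to\mathrm{Cat}$ be the restriction of the usual embedding $\Delta\to\mathrm{Cat}$; this is the weight for reflexive lax codescent objects, i.e. the reflexive lax codescent object of $D:\Delta_2^{op}\to\mathcal C$ is the weighted colimit $W_l\star D$, defined by isomorphisms $\mathcal C(W_l\star D,A)\cong[\Delta_2,\mathrm{Cat}](W_l,\mathcal C(D-,A))$ induced by a universal cocone $W_l\to\mathcal C(D-,W_l\star D)$. Proposition. Reflexive lax codescent objects are sifted flexible colimits. That is: (1) (sifted) $W_l$-weighted colimits exist in $\mathrm{Cat}$ and $W_l\star-:[\Delta_2^{op},\mathrm{Cat}]\to\mathrm{Cat}$ preserves finite products; (2) (flexible) $W_l$ is a flexible weight: if $p:W_l\rightsquigarrow QW_l$ is the pseudomorphism classifier of $W_l$ (the pseudonatural transformation for which composition with $p$ gives isomorphisms of categories $[\Delta_2,\mathrm{Cat}](QW_l,X)\cong \mathrm{Ps}(\Delta_2,\mathrm{Cat})(W_l,X)$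 for all $X$, where $\mathrm{Ps}(\Delta_2,\mathrm{Cat})$ has 2-functors, pseudonatural transformations and modifications), which exists, then the unique 2-natural transformation $q:QW_l\to W_l$ with $q\circ p=1$ has a section in $[\Delta_2,\mathrm{Cat}]$. -/

import Mathlib

open CategoryTheory CategoryTheory.Limits CategoryTheory.Bicategory Opposite
open scoped CategoryTheory.Pseudofunctor.StrongTrans

universe w v u

noncomputable section

/-! `Cat` is the 2-category of small categories.  The index `J` is a category, viewed as a locally
discrete 2-category.  Then 2-functors `J → Cat` are functors `J ⥤ Cat`, and 2-natural
transformations are natural transformations, since `J` has no non-identity 2-cells. -/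

namespace CatWeight

variable {J : Type w} [Category.{v} J]

section Coherence

/-! Equalities between composites of identity 2-cells in a strict bicategory. -/

variable {B : Type*} [Bicategory B] [Strict B]

theorem strict_naturality {a b c d : B} {f f' : a ⟶ b} {g g' : c ⟶ d} {h : b ⟶ d} {k : a ⟶ c}
    (ef : f = f') (eg : g = g') (e : f ≫ h = k ≫ g) (e' : f' ≫ h = k ≫ g') :
    eqToHom ef ▷ h ≫ (eqToIso e').hom = (eqToIso e).hom ≫ k ◁ eqToHom eg := by
  subst ef eg
  simp

theorem strict_naturality_id {a b : B} {f : a ⟶ a} {g : b ⟶ b} {h : a ⟶ b}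
    (ef : f = 𝟙 a) (eg : g = 𝟙 b) (e : f ≫ h = h ≫ g) :
    (eqToIso e).hom ≫ h ◁ (eqToIso eg).hom =
      (eqToIso ef).hom ▷ h ≫ (λ_ h).hom ≫ (ρ_ h).inv := by
  subst ef eg
  simp [Strict.leftUnitor_eqToIso, Strict.rightUnitor_eqToIso]

theorem strict_naturality_comp {a b c a' b' c' : B} {f : a ⟶ b} {g : b ⟶ c} {fg : a ⟶ c}
    {f' : a' ⟶ b'} {g' : b' ⟶ c'} {fg' : a' ⟶ c'} {x : a ⟶ a'} {y : b ⟶ b'} {z : c ⟶ c'}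
    (h : fg = f ≫ g) (h' : fg' = f' ≫ g') (ef : f ≫ y = x ≫ f') (eg : g ≫ z = y ≫ g')
    (e : fg ≫ z = x ≫ fg') :
    (eqToIso e).hom ≫ x ◁ (eqToIso h').hom =
      (eqToIso h).hom ▷ z ≫ (α_ _ _ _).hom ≫ f ◁ (eqToIso eg).hom ≫
        (α_ _ _ _).inv ≫ (eqToIso ef).hom ▷ g' ≫ (α_ _ _ _).hom := by
  subst h h'
  simp [Strict.associator_eqToIso, eqToHom_whiskerRight, whiskerLeft_eqToHom]

end Coherence

/-- A 2-natural transformation, seen as a pseudonatural transformation whose structure 2-cells are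
identities: the identity-on-objects inclusion `[J, Cat] → Ps(J, Cat)` on 1-cells.
The 2-cells `α ⟶ β` of `[J, Cat]` are the modifications, that is, the elements of
`strictTrans α ⟶ strictTrans β` in the bicategory of pseudofunctors. -/
def strictTrans {W X : J ⥤ Cat.{u, u}} (α : W ⟶ X) :
    W.toPseudofunctor' ⟶ X.toPseudofunctor' where
  app j := α.app j.as
  naturality f := eqToIso (α.naturality f.as)
  naturality_naturality η := by
    obtain rfl := LocallyDiscrete.eq_of_hom η
    exact strict_naturality rfl rfl (α.naturality _) (α.naturality _)
  naturality_id _ := strict_naturality_id _ _ _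
  naturality_comp := by
    rintro _ _ _ ⟨f⟩ ⟨g⟩
    exact strict_naturality_comp _ _ (α.naturality f) (α.naturality g) _

/-- A pseudonatural `p : W ⇝ Q` exhibits `Q` as the pseudomorphism classifier of `W`:
composition with `p` is an isomorphism of categories `[J, Cat](Q, X) ≅ Ps(J, Cat)(W, X)`
for each `X`, the first conjunct being bijectivity on objects, the others on morphisms. -/
def IsPseudomorphismClassifier {W Q : J ⥤ Cat.{u, u}}
    (p : W.toPseudofunctor' ⟶ Q.toPseudofunctor') : Prop :=
  ∀ X : J ⥤ Cat.{u, u},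
    Function.Bijective
      (fun α : Q ⟶ X => (p ≫ strictTrans α : W.toPseudofunctor' ⟶ X.toPseudofunctor')) ∧
    ∀ (α β : Q ⟶ X), Function.Bijective
      (fun Γ : strictTrans α ⟶ strictTrans β => p ◁ Γ)

/-- `W` is flexible: the counit `q : Q ⟶ W` at `W`, i.e. the (unique) 2-natural transformation out
of the pseudomorphism classifier `p : W ⇝ Q` with `q ∘ p = 1`, has a section in `[J, Cat]`. -/
def IsFlexible (W : J ⥤ Cat.{u, u}) : Prop :=
  ∃ (Q : J ⥤ Cat.{u, u}) (p : W.toPseudofunctor' ⟶ Q.toPseudofunctor'),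
    IsPseudomorphismClassifier p ∧
      ∃ q : Q ⟶ W, p ≫ strictTrans q = 𝟙 W.toPseudofunctor' ∧ ∃ s : W ⟶ Q, s ≫ q = 𝟙 W

/-- The 2-functor `Cat(D-, A) : J → Cat`, for a diagram `D : Jᵒᵖ → Cat` and a category `A`. -/
def homFunctor (D : Jᵒᵖ ⥤ Cat.{u, u}) (A : Cat.{u, u}) : J ⥤ Cat.{u, u} where
  obj j := Cat.of (D.obj (op j) ⥤ A)
  map f := ((Functor.whiskeringLeft _ _ A).obj (D.map f.op).toFunctor).toCatHom
  map_id j := by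
    rw [op_id, D.map_id]; rfl
  map_comp f g := by
    rw [op_comp, D.map_comp]; rfl

/-- Postcomposition `Cat(D-, A) ⟶ Cat(D-, B)` with a functor `A ⟶ B`. -/
def homPost (D : Jᵒᵖ ⥤ Cat.{u, u}) {A B : Cat.{u, u}} (F : A ⟶ B) :
    homFunctor D A ⟶ homFunctor D B where
  app j := ((Functor.whiskeringRight (D.obj (op j)) A B).obj F.toFunctor).toCatHom

/-- Postcomposition with a natural transformation `F ⟶ G`, a modification. -/
def homPost₂ (D : Jᵒᵖ ⥤ Cat.{u, u}) {A B : Cat.{u, u}} {F G : A ⟶ B} (η : F ⟶ G) :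
    strictTrans (homPost D F) ⟶ strictTrans (homPost D G) where
  as :=
    { app := fun j => NatTrans.toCatHom₂
        ((Functor.whiskeringRight (D.obj (op j.as)) A B).map η.toNatTrans)
      naturality := by
        rintro j k ⟨f⟩
        apply Cat.Hom₂.ext
        apply NatTrans.ext
        funext X
        exact (Category.comp_id _).trans (Category.id_comp _).symm }

/-- Precomposition `Cat(E-, A) ⟶ Cat(D-, A)` with a transformation of diagrams `D ⟶ E`. -/
def homPre {D E : Jᵒᵖ ⥤ Cat.{u, u}} (t : D ⟶ E) (A : Cat.{u, u}) :
    homFunctor E A ⟶ homFunctor D A where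
  app j := ((Functor.whiskeringLeft _ _ A).obj (t.app (op j)).toFunctor).toCatHom
  naturality j k f := by
    have h := congrArg (fun s : D.obj (op k) ⟶ E.obj (op j) =>
      ((Functor.whiskeringLeft _ _ A).obj s.toFunctor).toCatHom) (t.naturality f.op)
    exact h.symm

/-- The cocone (cylinder) `γ : W ⟶ Cat(D-, C)` exhibits `C` as the `W`-weighted colimit of `D`:
it induces an isomorphism of categories `Cat(C, A) ≅ [J, Cat](W, Cat(D-, A))` for each `A`, the
first conjunct being bijectivity on objects, the others on morphisms. -/
def IsWeightedColimit {W : J ⥤ Cat.{u, u}} {D : Jᵒᵖ ⥤ Cat.{u, u}} {C : Cat.{u, u}}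
    (γ : W ⟶ homFunctor D C) : Prop :=
  ∀ A : Cat.{u, u},
    Function.Bijective (fun F : C ⟶ A => γ ≫ homPost D F) ∧
    ∀ (F G : C ⟶ A), Function.Bijective (fun η : F ⟶ G => strictTrans γ ◁ homPost₂ D η)

/-- `F` is (the underlying functor of) `W ⋆ - : [Jᵒᵖ, Cat] → Cat`: each `F.obj D` is a `W`-weighted
colimit of `D`, and the universal cocones are natural in `D`. -/
structure WeightedColimitFunctor (W : J ⥤ Cat.{u, u})
    (F : (Jᵒᵖ ⥤ Cat.{u, u}) ⥤ Cat.{u, u}) where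
  /-- The universal cocones. -/
  cocone : ∀ D : Jᵒᵖ ⥤ Cat.{u, u}, W ⟶ homFunctor D (F.obj D)
  isWeightedColimit : ∀ D, IsWeightedColimit (cocone D)
  naturality : ∀ {D E : Jᵒᵖ ⥤ Cat.{u, u}} (t : D ⟶ E),
    cocone D ≫ homPost D (F.map t) = cocone E ≫ homPre t (F.obj E)

/-- `W` is sifted: `W ⋆ - : [Jᵒᵖ, Cat] → Cat` (which exists, and is then unique up to isomorphism)
preserves finite products.  A cone on a discrete diagram in `Cat` or `[Jᵒᵖ, Cat]` is a product in
the 2-categorical sense if and only if it is one in the underlying category, so that it is enough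
to speak of the underlying functor. -/
def IsSifted (W : J ⥤ Cat.{u, u}) : Prop :=
  ∃ F : (Jᵒᵖ ⥤ Cat.{u, u}) ⥤ Cat.{u, u},
    Nonempty (WeightedColimitFunctor W F) ∧ PreservesFiniteProducts F

end CatWeight

/-- The weight `W_l : Δ₂ → Cat` for reflexive lax codescent objects: the restriction to
`Δ₂ = {[0], [1], [2]} ⊂ Δ` of the usual embedding `Δ → Cat`.  The functor `Cat.asSmallFunctor`
only replaces each poset category by the isomorphic copy of it in universe `u`. -/
def reflexiveLaxCodescentWeight : SimplexCategory.Truncated 2 ⥤ Cat.{u, u} :=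
  SimplexCategory.Truncated.inclusion 2 ⋙ SimplexCategory.toCat ⋙ Cat.asSmallFunctor.{u, 0, 0}

end

noncomputable section

namespace CatWeight

/-! ### Pseudonatural transformations between `Cat`-valued functors, in components -/

section Functoriality

variable {J : Type w} [Category.{v} J] (X : J ⥤ Cat.{u, u})

/-! Both halves rest on explicit models.

Flexibility. The classifier of `W` makes the action of `J` on objects free and leaves the morphisms
alone: an object over `j` is a formal image `(i, f : i ⟶ j, x)` with `x` in `W i`, and a morphism is
a morphism of `W j` between the values `W f x`. A pseudonatural `σ` extends strictly by `(i, f, x) ↦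
X f (σ x)`, its 2-cells being absorbed into the action on morphisms
(`isPseudomorphismClassifier_classifierUnit`). The counit is evaluation, which is fully faithful in
each component. So a section amounts to a choice, natural in `j`, of a formal image with prescribed
value for each object (`isFlexible_of_formalImage`). For `W_l` such a choice exists because the
objects of `[n]` are exactly the maps `[0] ⟶ [n]`: the functor of objects is representable.

Siftedness. `Codescent D` is given by generators and relations: its objects are those of `D [0]`,
and its morphisms are generated by those of `D [0]` and by a cell for each morphism of `[n]` and
each object of `D [n]`. Its universal property is read off from the presentation
(`isWeightedColimit_universalCocone`), and functoriality in `D` follows.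

For binary products, the comparison `Codescent (D × E) ⥤ Codescent D × Codescent E` gets an inverse
`ofProd`, sending `(f, g)` to `left f ≫ right g`. The functors `left` and `right` fix an object of
the other factor by pairing cells with degenerate simplices; this is where reflexivity is used.
`ofProd` is a functor because `left f` and `right g` commute (`interchange`). On generators the
essential case is that of two cells. Every morphism of `[n]` comes from `[1]`, and there both
composites equal the cell at `(x, y)`, as the 2-simplices `(s₁ x, s₀ y)` and `(s₀ x, s₁ y)` show:
these are the two triangles of the square `[1] × [1]`. The same triangles show that `ofProd` hits
the cells of the product. The terminal diagram is handled directly, since all its cells are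
degenerate, hence identities. -/

theorem map_id_obj {j : J} (x : X.obj j) : (X.map (𝟙 j)).toFunctor.obj x = x := by
  rw [X.map_id]; rfl

theorem map_comp_obj {i j k : J} (f : i ⟶ j) (g : j ⟶ k) (x : X.obj i) :
    (X.map (f ≫ g)).toFunctor.obj x = (X.map g).toFunctor.obj ((X.map f).toFunctor.obj x) := by
  rw [X.map_comp]; rfl

theorem map_id_map {j : J} {x y : X.obj j} (m : x ⟶ y) :
    (X.map (𝟙 j)).toFunctor.map m =
      eqToHom (map_id_obj X x) ≫ m ≫ eqToHom (map_id_obj X y).symm :=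
  Functor.congr_hom (congrArg Cat.Hom.toFunctor (X.map_id j)) m

theorem map_comp_map {i j k : J} (f : i ⟶ j) (g : j ⟶ k) {x y : X.obj i} (m : x ⟶ y) :
    (X.map (f ≫ g)).toFunctor.map m =
      eqToHom (map_comp_obj X f g x) ≫ (X.map g).toFunctor.map ((X.map f).toFunctor.map m) ≫
        eqToHom (map_comp_obj X f g y).symm :=
  Functor.congr_hom (congrArg Cat.Hom.toFunctor (X.map_comp f g)) m

variable {X} {Y : J ⥤ Cat.{u, u}}

theorem naturality_obj (α : X ⟶ Y) {i j : J} (f : i ⟶ j) (x : X.obj i) :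
    (α.app j).toFunctor.obj ((X.map f).toFunctor.obj x) =
      (Y.map f).toFunctor.obj ((α.app i).toFunctor.obj x) :=
  Functor.congr_obj (congrArg Cat.Hom.toFunctor (α.naturality f)) x

theorem naturality_map (α : X ⟶ Y) {i j : J} (f : i ⟶ j) {x y : X.obj i} (m : x ⟶ y) :
    (α.app j).toFunctor.map ((X.map f).toFunctor.map m) =
      eqToHom (naturality_obj α f x) ≫ (Y.map f).toFunctor.map ((α.app i).toFunctor.map m) ≫
        eqToHom (naturality_obj α f y).symm :=
  Functor.congr_hom (congrArg Cat.Hom.toFunctor (α.naturality f)) m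

variable (X Y) in
/-- A pseudonatural transformation between `Cat`-valued functors, in terms of functors and of
isomorphisms between objects. -/
structure PseudoNat where
  /-- The components. -/
  app (j : J) : X.obj j ⥤ Y.obj j
  /-- The structure 2-cells. -/
  iso {i j : J} (f : i ⟶ j) (x : X.obj i) :
    (app j).obj ((X.map f).toFunctor.obj x) ≅ (Y.map f).toFunctor.obj ((app i).obj x)
  iso_naturality {i j : J} (f : i ⟶ j) {x y : X.obj i} (m : x ⟶ y) :
    (app j).map ((X.map f).toFunctor.map m) ≫ (iso f y).hom =
      (iso f x).hom ≫ (Y.map f).toFunctor.map ((app i).map m)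
  iso_id (j : J) (x : X.obj j) :
    (iso (𝟙 j) x).hom = (app j).map (eqToHom (map_id_obj X x)) ≫
      eqToHom (map_id_obj Y ((app j).obj x)).symm
  iso_comp {i j k : J} (f : i ⟶ j) (g : j ⟶ k) (x : X.obj i) :
    (iso (f ≫ g) x).hom = (app k).map (eqToHom (map_comp_obj X f g x)) ≫
      (iso g ((X.map f).toFunctor.obj x)).hom ≫ (Y.map g).toFunctor.map (iso f x).hom ≫
        eqToHom (map_comp_obj Y f g ((app i).obj x)).symm

namespace PseudoNat

theorem iso_naturality_assoc (σ : PseudoNat X Y) {i j : J} (f : i ⟶ j) {x y : X.obj i} (m : x ⟶ y)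
    {z : Y.obj j} (h : (Y.map f).toFunctor.obj ((σ.app i).obj y) ⟶ z) :
    (σ.app j).map ((X.map f).toFunctor.map m) ≫ (σ.iso f y).hom ≫ h =
      (σ.iso f x).hom ≫ (Y.map f).toFunctor.map ((σ.app i).map m) ≫ h := by
  simp only [← Category.assoc, σ.iso_naturality]

/-- Needed because maps such as `𝟙 j ≫ f` and `f` index 2-cells of different types. -/
theorem iso_hom_of_eq (σ : PseudoNat X Y) {i j : J} {f g : i ⟶ j} (h : f = g) (x : X.obj i) :
    (σ.iso f x).hom = (σ.app j).map (eqToHom (by rw [h])) ≫ (σ.iso g x).hom ≫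
      eqToHom (by rw [h]) := by
  subst h
  simp

theorem iso_id_inv (σ : PseudoNat X Y) (j : J) (x : X.obj j) :
    (σ.iso (𝟙 j) x).inv = eqToHom (map_id_obj Y ((σ.app j).obj x)) ≫
      (σ.app j).map (eqToHom (map_id_obj X x).symm) := by
  rw [← cancel_epi (σ.iso (𝟙 j) x).hom, Iso.hom_inv_id, iso_id]
  simp [eqToHom_map]

theorem iso_comp_inv (σ : PseudoNat X Y) {i j k : J} (f : i ⟶ j) (g : j ⟶ k) (x : X.obj i) :
    (σ.iso (f ≫ g) x).inv = eqToHom (map_comp_obj Y f g ((σ.app i).obj x)) ≫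
      (Y.map g).toFunctor.map (σ.iso f x).inv ≫
        (σ.iso g ((X.map f).toFunctor.obj x)).inv ≫
          (σ.app k).map (eqToHom (map_comp_obj X f g x).symm) := by
  rw [← cancel_epi (σ.iso (f ≫ g) x).hom, Iso.hom_inv_id, iso_comp]
  simp [eqToHom_map, ← CategoryTheory.Functor.map_comp_assoc]

theorem ext {σ τ : PseudoNat X Y} (h : ∀ j, σ.app j = τ.app j)
    (h' : ∀ {i j : J} (f : i ⟶ j) (x : X.obj i),
      (σ.iso f x).hom = eqToHom (Functor.congr_obj (h j) _) ≫ (τ.iso f x).hom ≫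
        eqToHom (congrArg (Y.map f).toFunctor.obj (Functor.congr_obj (h i) x).symm)) :
    σ = τ := by
  obtain ⟨a, n, _, _, _⟩ := σ
  obtain ⟨b, m, _, _, _⟩ := τ
  obtain rfl : a = b := funext h
  congr 1
  funext i j f x
  apply Iso.ext
  simpa using h' f x

theorem app_congr {σ τ : PseudoNat X Y} (h : σ = τ) (j : J) : σ.app j = τ.app j := by
  rw [h]

theorem iso_congr {σ τ : PseudoNat X Y} (h : σ = τ) {i j : J} (f : i ⟶ j) (x : X.obj i) :
    (σ.iso f x).hom = eqToHom (Functor.congr_obj (app_congr h j) _) ≫ (τ.iso f x).hom ≫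
      eqToHom (congrArg (Y.map f).toFunctor.obj (Functor.congr_obj (app_congr h i) x).symm) := by
  subst h
  simp

theorem mapId_hom_app {j : J} (x : X.obj j) :
    (X.toPseudofunctor'.mapId ⟨j⟩).hom.toNatTrans.app x = eqToHom (map_id_obj X x) :=
  Cat.eqToHom_app _ _ (X.map_id j) x

theorem mapComp_hom_app {i j k : J} (f : i ⟶ j) (g : j ⟶ k) (x : X.obj i) :
    (X.toPseudofunctor'.mapComp (Quiver.Hom.toLoc f) (Quiver.Hom.toLoc g)).hom.toNatTrans.app x =
      eqToHom (map_comp_obj X f g x) :=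
  Cat.eqToHom_app _ _ (X.map_comp f g) x

/-- The identities here and in the next lemma stand for components of unitors and associators of
`Cat`, which are identities only after unfolding; stated abstractly, the cancellation applies up to
definitional equality. -/
theorem comp_id_comp_id {C : Type*} [Category* C] {a b : C} (f : a ⟶ b) :
    f ≫ 𝟙 b ≫ 𝟙 b = f := by
  simp

theorem comp_id_comp_id_comp_id {C : Type*} [Category* C] {a b c d : C} (f : a ⟶ b) (g : b ⟶ c)
    (h : c ⟶ d) : f ≫ 𝟙 b ≫ g ≫ 𝟙 c ≫ h ≫ 𝟙 d = f ≫ g ≫ h := by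
  simp

/-- The explicit form of a strong transformation. -/
def ofStrongTrans (σ : X.toPseudofunctor' ⟶ Y.toPseudofunctor') : PseudoNat X Y where
  app j := (σ.app ⟨j⟩).toFunctor
  iso f x := (Cat.Hom.toNatIso (σ.naturality (Quiver.Hom.toLoc f))).app x
  iso_naturality f _ _ m := (σ.naturality (Quiver.Hom.toLoc f)).hom.toNatTrans.naturality m
  iso_id j x := by
    have h : (σ.naturality (Quiver.Hom.toLoc (𝟙 j))).hom.toNatTrans.app x ≫
        (Y.toPseudofunctor'.mapId ⟨j⟩).hom.toNatTrans.app ((σ.app ⟨j⟩).toFunctor.obj x) =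
        (σ.app ⟨j⟩).toFunctor.map ((X.toPseudofunctor'.mapId ⟨j⟩).hom.toNatTrans.app x) ≫
          𝟙 _ ≫ 𝟙 _ :=
      NatTrans.congr_app (congrArg Cat.Hom₂.toNatTrans (σ.naturality_id ⟨j⟩)) x
    refine (comp_eqToHom_iff (map_id_obj Y ((σ.app ⟨j⟩).toFunctor.obj x)) _ _).1 ?_
    refine (congrArg _ (mapId_hom_app _).symm).trans (h.trans ?_)
    exact (comp_id_comp_id _).trans
      (congrArg (σ.app ⟨j⟩).toFunctor.map (mapId_hom_app x))
  iso_comp {i j k} f g x := by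
    have h : (σ.naturality (Quiver.Hom.toLoc (f ≫ g))).hom.toNatTrans.app x ≫
        (Y.toPseudofunctor'.mapComp (Quiver.Hom.toLoc f) (Quiver.Hom.toLoc g)).hom.toNatTrans.app
          ((σ.app ⟨i⟩).toFunctor.obj x) =
        (σ.app ⟨k⟩).toFunctor.map
          ((X.toPseudofunctor'.mapComp (Quiver.Hom.toLoc f)
            (Quiver.Hom.toLoc g)).hom.toNatTrans.app x) ≫
          𝟙 _ ≫ (σ.naturality (Quiver.Hom.toLoc g)).hom.toNatTrans.app
            ((X.map f).toFunctor.obj x) ≫ 𝟙 _ ≫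
            (Y.map g).toFunctor.map ((σ.naturality (Quiver.Hom.toLoc f)).hom.toNatTrans.app x) ≫
              𝟙 _ :=
      NatTrans.congr_app (congrArg Cat.Hom₂.toNatTrans
        (σ.naturality_comp (Quiver.Hom.toLoc f) (Quiver.Hom.toLoc g))) x
    have h' := (comp_eqToHom_iff (map_comp_obj Y f g ((σ.app ⟨i⟩).toFunctor.obj x)) _ _).1
      ((congrArg _ (mapComp_hom_app f g _).symm).trans h)
    refine h'.trans ?_
    refine (congrArg (· ≫ eqToHom _) (comp_id_comp_id_comp_id _ _ _)).trans ?_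
    refine (Category.assoc _ _ _).trans ((congrArg _ (Category.assoc _ _ _)).trans ?_)
    exact congrArg (· ≫ _) (congrArg (σ.app ⟨k⟩).toFunctor.map (mapComp_hom_app f g x))

/-- The strong transformation with given explicit form. -/
def toStrongTrans (σ : PseudoNat X Y) : X.toPseudofunctor' ⟶ Y.toPseudofunctor' where
  app j := (σ.app j.as).toCatHom
  naturality {i j} f := Cat.Hom.isoMk (NatIso.ofComponents
    (F := (X.map f.as).toFunctor ⋙ σ.app j.as) (G := σ.app i.as ⋙ (Y.map f.as).toFunctor)
    (σ.iso f.as) (σ.iso_naturality f.as))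
  naturality_naturality η := by
    obtain rfl := LocallyDiscrete.eq_of_hom η
    obtain rfl := Subsingleton.elim η (𝟙 _)
    rw [PrelaxFunctor.map₂_id, PrelaxFunctor.map₂_id]
    exact (congrArg (· ≫ _) (id_whiskerRight _ _)).trans ((Category.id_comp _).trans
      ((Category.comp_id _).symm.trans (congrArg _ (whiskerLeft_id _ _).symm)))
  naturality_id j := by
    apply Cat.Hom₂.ext
    apply NatTrans.ext
    funext x
    have h := (comp_eqToHom_iff (map_id_obj Y ((σ.app j.as).obj x)) _ _).2 (σ.iso_id j.as x)
    refine (congrArg _ (mapId_hom_app _)).trans (h.trans ?_)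
    refine .trans ?_ (comp_id_comp_id _).symm
    exact (congrArg (σ.app j.as).map (mapId_hom_app x)).symm
  naturality_comp {i j k} f g := by
    apply Cat.Hom₂.ext
    apply NatTrans.ext
    funext x
    have h := (comp_eqToHom_iff (map_comp_obj Y f.as g.as ((σ.app i.as).obj x)) _ _).2
      ((σ.iso_comp f.as g.as x).trans ((congrArg _ (Category.assoc _ _ _).symm).trans
        (Category.assoc _ _ _).symm))
    refine (congrArg _ (mapComp_hom_app f.as g.as _)).trans (h.trans ?_)
    refine .trans ?_ (comp_id_comp_id_comp_id _ _ _).symm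
    exact congrArg (· ≫ _) (congrArg (σ.app k.as).map (mapComp_hom_app f.as g.as x).symm)

/-- The two descriptions of pseudonatural transformations. -/
def equivStrongTrans : (X.toPseudofunctor' ⟶ Y.toPseudofunctor') ≃ PseudoNat X Y where
  toFun := ofStrongTrans
  invFun := toStrongTrans
  left_inv _ := rfl
  right_inv _ := rfl

end PseudoNat

end Functoriality
end CatWeight

namespace CatWeight

/-! ### Modifications, in components -/

section Modifications

variable {J : Type w} [Category.{v} J] {X Y Z : J ⥤ Cat.{u, u}}

theorem modification_naturality_app {σ τ : X.toPseudofunctor' ⟶ Y.toPseudofunctor'} (Γ : σ ⟶ τ)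
    {i j : J} (f : i ⟶ j) (x : X.obj i) :
    (Γ.as.app ⟨j⟩).toNatTrans.app ((X.map f).toFunctor.obj x) ≫
        ((PseudoNat.ofStrongTrans τ).iso f x).hom =
      ((PseudoNat.ofStrongTrans σ).iso f x).hom ≫
        (Y.map f).toFunctor.map ((Γ.as.app ⟨i⟩).toNatTrans.app x) :=
  NatTrans.congr_app (congrArg Cat.Hom₂.toNatTrans (Γ.as.naturality (Quiver.Hom.toLoc f))) x

/-- Modifications, in terms of natural transformations. -/
def modificationMk {σ τ : X.toPseudofunctor' ⟶ Y.toPseudofunctor'}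
    (Γ : ∀ j, (PseudoNat.ofStrongTrans σ).app j ⟶ (PseudoNat.ofStrongTrans τ).app j)
    (h : ∀ {i j : J} (f : i ⟶ j) (x : X.obj i),
      (Γ j).app ((X.map f).toFunctor.obj x) ≫ ((PseudoNat.ofStrongTrans τ).iso f x).hom =
        ((PseudoNat.ofStrongTrans σ).iso f x).hom ≫ (Y.map f).toFunctor.map ((Γ i).app x)) :
    σ ⟶ τ where
  as :=
    { app := fun j => ⟨Γ j.as⟩
      naturality := fun f => Cat.Hom₂.ext (NatTrans.ext (funext (h f.as))) }

theorem ofStrongTrans_strictTrans_iso_hom (α : X ⟶ Y) {i j : J} (f : i ⟶ j) (x : X.obj i) :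
    ((PseudoNat.ofStrongTrans (strictTrans α)).iso f x).hom = eqToHom (naturality_obj α f x) :=
  Cat.eqToHom_app _ _ (α.naturality f) x

theorem strictTrans_modification_app {α β : X ⟶ Y} (Γ : strictTrans α ⟶ strictTrans β)
    {i j : J} (f : i ⟶ j) (x : X.obj i) :
    (Γ.as.app ⟨j⟩).toNatTrans.app ((X.map f).toFunctor.obj x) =
      eqToHom (naturality_obj α f x) ≫
        (Y.map f).toFunctor.map ((Γ.as.app ⟨i⟩).toNatTrans.app x) ≫
          eqToHom (naturality_obj β f x).symm := by
  have h := modification_naturality_app Γ f x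
  rw [ofStrongTrans_strictTrans_iso_hom, ofStrongTrans_strictTrans_iso_hom] at h
  exact ((comp_eqToHom_iff _ _ _).1 h).trans (Category.assoc _ _ _)

theorem ofStrongTrans_comp_strictTrans_iso_hom (p : X.toPseudofunctor' ⟶ Y.toPseudofunctor')
    (α : Y ⟶ Z) {i j : J} (f : i ⟶ j) (x : X.obj i) :
    ((PseudoNat.ofStrongTrans (p ≫ strictTrans α)).iso f x).hom =
      (α.app j).toFunctor.map ((PseudoNat.ofStrongTrans p).iso f x).hom ≫
        eqToHom (naturality_obj α f ((p.app ⟨i⟩).toFunctor.obj x)) := by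
  have h : ((PseudoNat.ofStrongTrans (p ≫ strictTrans α)).iso f x).hom =
      𝟙 _ ≫ (α.app j).toFunctor.map ((PseudoNat.ofStrongTrans p).iso f x).hom ≫ 𝟙 _ ≫
        ((PseudoNat.ofStrongTrans (strictTrans α)).iso f ((p.app ⟨i⟩).toFunctor.obj x)).hom ≫ 𝟙 _ :=
    rfl
  refine h.trans ((Category.id_comp _).trans (congrArg _ ?_))
  exact (Category.id_comp _).trans ((Category.comp_id _).trans
    (ofStrongTrans_strictTrans_iso_hom α f _))

/-- The condition on 2-cells for a weighted colimit concerns modifications between composites of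
strict transformations; the structure 2-cells of such a composite are still transports. -/
theorem strictTrans_comp_modification_app {Y' : J ⥤ Cat.{u, u}} {α : X ⟶ Y} {β : Y ⟶ Z}
    {α' : X ⟶ Y'} {β' : Y' ⟶ Z}
    (Γ : strictTrans α ≫ strictTrans β ⟶ strictTrans α' ≫ strictTrans β')
    {i j : J} (f : i ⟶ j) (x : X.obj i) :
    (Γ.as.app ⟨j⟩).toNatTrans.app ((X.map f).toFunctor.obj x) =
      eqToHom (naturality_obj (α ≫ β) f x) ≫
        (Z.map f).toFunctor.map ((Γ.as.app ⟨i⟩).toNatTrans.app x) ≫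
          eqToHom (naturality_obj (α' ≫ β') f x).symm := by
  have hom_eq {Y : J ⥤ Cat.{u, u}} (α : X ⟶ Y) (β : Y ⟶ Z) :
      ((PseudoNat.ofStrongTrans (strictTrans α ≫ strictTrans β)).iso f x).hom =
        eqToHom (naturality_obj (α ≫ β) f x) := by
    refine (ofStrongTrans_comp_strictTrans_iso_hom _ _ f x).trans ?_
    rw [ofStrongTrans_strictTrans_iso_hom]
    exact (congrArg (· ≫ _) (eqToHom_map (β.app j).toFunctor (naturality_obj α f x))).trans
      (eqToHom_trans _ _)
  have h := modification_naturality_app Γ f x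
  rw [hom_eq, hom_eq] at h
  exact ((comp_eqToHom_iff _ _ _).1 h).trans (Category.assoc _ _ _)

end Modifications

/-! ### The pseudomorphism classifier, by formal images -/

section Classifier

variable {J : Type} [Category.{0} J] (W : J ⥤ Cat.{u, u})

/-- Formal images in `W.obj j` of objects of the categories `W.obj i`. -/
structure FormalImage (j : J) : Type u where
  /-- The source of the map. -/
  source : J
  /-- The map. -/
  hom : source ⟶ j
  /-- The object. -/
  obj : W.obj source

namespace FormalImage

variable {W}

/-- The actual image. -/
abbrev val {j : J} (x : FormalImage W j) : W.obj j := (W.map x.hom).toFunctor.obj x.obj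

/-- The formal image of a formal image. -/
abbrev push {j k : J} (g : j ⟶ k) (x : FormalImage W j) : FormalImage W k :=
  ⟨x.source, x.hom ≫ g, x.obj⟩

theorem val_push {j k : J} (g : j ⟶ k) (x : FormalImage W j) :
    (x.push g).val = (W.map g).toFunctor.obj x.val :=
  map_comp_obj W x.hom g x.obj

theorem push_id {j : J} (x : FormalImage W j) : x.push (𝟙 j) = x := by
  simp [push]

theorem push_comp {i j k : J} (f : i ⟶ j) (g : j ⟶ k) (x : FormalImage W i) :
    x.push (f ≫ g) = (x.push f).push g := by
  simp [push]

/-- Morphisms of formal images are morphisms of images. -/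
@[ext]
structure Hom {j : J} (x y : FormalImage W j) : Type u where
  /-- The morphism of images. -/
  val : x.val ⟶ y.val

@[simps id_val comp_val]
instance (j : J) : Category.{u} (FormalImage W j) where
  Hom := Hom
  id x := ⟨𝟙 x.val⟩
  comp m n := ⟨m.val ≫ n.val⟩

@[ext]
theorem hom_ext {j : J} {x y : FormalImage W j} {m n : x ⟶ y} (h : m.val = n.val) : m = n :=
  Hom.ext h

@[simp]
theorem eqToHom_val {j : J} {x y : FormalImage W j} (h : x = y) :
    (eqToHom h).val = eqToHom (congrArg val h) := by
  subst h
  rfl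

/-- The action of `J` on formal images. -/
@[simps]
abbrev pushFunctor {j k : J} (g : j ⟶ k) : FormalImage W j ⥤ FormalImage W k where
  obj x := x.push g
  map {x y} m := ⟨eqToHom (val_push g x) ≫ (W.map g).toFunctor.map m.val ≫
    eqToHom (val_push g y).symm⟩
  map_id x := hom_ext (by simp)
  map_comp f g := hom_ext (by simp)

theorem pushFunctor_id (j : J) : pushFunctor (𝟙 j) = 𝟭 (FormalImage W j) :=
  CategoryTheory.Functor.ext push_id fun x y m => hom_ext (by simp [map_id_map])

theorem pushFunctor_comp {i j k : J} (f : i ⟶ j) (g : j ⟶ k) :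
    pushFunctor (W := W) (f ≫ g) = pushFunctor f ⋙ pushFunctor g :=
  CategoryTheory.Functor.ext (push_comp f g) fun x y m =>
    hom_ext (by simp [map_comp_map, eqToHom_map])

/-- Objects are their own formal images. -/
@[simps]
abbrev unitFunctor (j : J) : W.obj j ⥤ FormalImage W j where
  obj x := ⟨j, 𝟙 j, x⟩
  map m := ⟨(W.map (𝟙 j)).toFunctor.map m⟩
  map_id x := hom_ext (by simp [val])
  map_comp f g := hom_ext (by simp)

/-- The structure isomorphisms of the family `unitFunctor`. -/
@[simps]
def unitIso {i j : J} (f : i ⟶ j) (x : W.obj i) :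
    (unitFunctor j).obj ((W.map f).toFunctor.obj x) ≅
      (pushFunctor f).obj ((unitFunctor i).obj x) where
  hom := ⟨eqToHom (by simp [val, push])⟩
  inv := ⟨eqToHom (by simp [val, push])⟩

theorem unitIso_naturality {i j : J} (f : i ⟶ j) {x y : W.obj i} (m : x ⟶ y) :
    (unitFunctor j).map ((W.map f).toFunctor.map m) ≫ (unitIso f y).hom =
      (unitIso f x).hom ≫ (pushFunctor f).map ((unitFunctor i).map m) := by
  ext
  simp [map_id_map, eqToHom_map]

theorem unitIso_id (j : J) (x : W.obj j) :
    (unitIso (𝟙 j) x).hom = (unitFunctor j).map (eqToHom (map_id_obj W x)) ≫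
      eqToHom (push_id ((unitFunctor j).obj x)).symm := by
  ext
  simp [eqToHom_map]

theorem unitIso_comp {i j k : J} (f : i ⟶ j) (g : j ⟶ k) (x : W.obj i) :
    (unitIso (f ≫ g) x).hom = (unitFunctor k).map (eqToHom (map_comp_obj W f g x)) ≫
      (unitIso g ((W.map f).toFunctor.obj x)).hom ≫ (pushFunctor g).map (unitIso f x).hom ≫
        eqToHom (push_comp f g ((unitFunctor i).obj x)).symm := by
  ext
  simp [eqToHom_map]

/-- Each formal image is isomorphic, through `unitIso`, to the unit at its value, so morphisms are
generated by images under `unitFunctor` and by the isomorphisms `unitIso`. This gives the uniqueness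
part of the universal property. -/
theorem hom_factorization {j : J} {x y : FormalImage W j} (m : x ⟶ y) :
    m = (eqToHom (by simp [push]) : x ⟶ (pushFunctor x.hom).obj ((unitFunctor x.source).obj x.obj)) ≫
      (unitIso x.hom x.obj).inv ≫ (unitFunctor j).map m.val ≫ (unitIso y.hom y.obj).hom ≫
        (eqToHom (by simp [push])) := by
  ext
  simp [map_id_map]

theorem push_unit {j : J} (x : FormalImage W j) :
    ((unitFunctor x.source).obj x.obj).push x.hom = x := by
  simp [push]

theorem functor_ext {j : J} {C : Type*} [Category* C] {a b : FormalImage W j ⥤ C}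
    (ho : ∀ x, a.obj x = b.obj x)
    (hu : ∀ {x y : W.obj j} (m : x ⟶ y), a.map ((unitFunctor j).map m) =
      eqToHom (ho _) ≫ b.map ((unitFunctor j).map m) ≫ eqToHom (ho _).symm)
    (hi : ∀ {i : J} (f : i ⟶ j) (x : W.obj i), a.map (unitIso f x).hom =
      eqToHom (ho _) ≫ b.map (unitIso f x).hom ≫ eqToHom (ho _).symm) : a = b := by
  have hi' {i : J} (f : i ⟶ j) (x : W.obj i) : a.map (unitIso f x).inv =
      eqToHom (ho _) ≫ b.map (unitIso f x).inv ≫ eqToHom (ho _).symm := by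
    rw [← cancel_epi (a.map (unitIso f x).hom), Iso.map_hom_inv_id, hi]
    simp only [Category.assoc, eqToHom_trans_assoc, eqToHom_refl, Category.id_comp,
      Iso.map_hom_inv_id_assoc, eqToHom_trans]
  refine CategoryTheory.Functor.ext ho fun x y m => ?_
  have hc {x y z : FormalImage W j} {m : x ⟶ y} {n : y ⟶ z}
      (hm : a.map m = eqToHom (ho _) ≫ b.map m ≫ eqToHom (ho _).symm)
      (hn : a.map n = eqToHom (ho _) ≫ b.map n ≫ eqToHom (ho _).symm) :
      a.map (m ≫ n) = eqToHom (ho _) ≫ b.map (m ≫ n) ≫ eqToHom (ho _).symm := by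
    simp [hm, hn]
  have he {x y : FormalImage W j} (h : x = y) :
      a.map (eqToHom h) = eqToHom (ho _) ≫ b.map (eqToHom h) ≫ eqToHom (ho _).symm := by
    simp [eqToHom_map]
  rw [hom_factorization m]
  exact hc (he _) (hc (hi' _ _) (hc (hu _) (hc (hi _ _) (he _))))

theorem naturality_of_unit {j : J} {C : Type*} [Category* C] {a b : FormalImage W j ⥤ C}
    (t : ∀ x, a.obj x ⟶ b.obj x)
    (hu : ∀ {x y : W.obj j} (m : x ⟶ y), a.map ((unitFunctor j).map m) ≫ t _ =
      t _ ≫ b.map ((unitFunctor j).map m))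
    (hi : ∀ {i : J} (f : i ⟶ j) (x : W.obj i), a.map (unitIso f x).hom ≫ t _ =
      t _ ≫ b.map (unitIso f x).hom) {x y : FormalImage W j} (m : x ⟶ y) :
    a.map m ≫ t y = t x ≫ b.map m := by
  have hi' {i : J} (f : i ⟶ j) (x : W.obj i) :
      a.map (unitIso f x).inv ≫ t _ = t _ ≫ b.map (unitIso f x).inv := by
    rw [← cancel_epi (a.map (unitIso f x).hom), Iso.map_hom_inv_id_assoc, reassoc_of% hi,
      Iso.map_hom_inv_id, Category.comp_id]
  have he {x y : FormalImage W j} (h : x = y) :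
      a.map (eqToHom h) ≫ t y = t x ≫ b.map (eqToHom h) := by
    subst h
    simp
  rw [hom_factorization m]
  simp only [CategoryTheory.Functor.map_comp, Category.assoc, he, reassoc_of% hu, reassoc_of% hi,
    reassoc_of% hi', reassoc_of% he]

variable {X : J ⥤ Cat.{u, u}}

/-- A formal image is the push of a unit, so strict naturality forces the values of `a` from those
on units. -/
theorem obj_eq {a : ∀ j, FormalImage W j ⥤ X.obj j}
    (ha : ∀ {j k} (g : j ⟶ k), pushFunctor g ⋙ a k = a j ⋙ (X.map g).toFunctor)
    {j : J} (x : FormalImage W j) : (a j).obj x =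
      (X.map x.hom).toFunctor.obj ((a x.source).obj ((unitFunctor x.source).obj x.obj)) :=
  (congrArg (a j).obj (push_unit x).symm).trans (Functor.congr_obj (ha x.hom) _)

section

variable {a b : ∀ j, FormalImage W j ⥤ X.obj j}
  (ha : ∀ {j k} (g : j ⟶ k), pushFunctor g ⋙ a k = a j ⋙ (X.map g).toFunctor)
  (hb : ∀ {j k} (g : j ⟶ k), pushFunctor g ⋙ b k = b j ⋙ (X.map g).toFunctor)

/-- The extension to formal images of a family of natural transformations. -/
def extend (G : ∀ j, unitFunctor j ⋙ a j ⟶ unitFunctor j ⋙ b j) {j : J} (x : FormalImage W j) :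
    (a j).obj x ⟶ (b j).obj x :=
  eqToHom (obj_eq ha x) ≫ (X.map x.hom).toFunctor.map ((G x.source).app x.obj) ≫
    eqToHom (obj_eq hb x).symm

theorem extend_unit (G : ∀ j, unitFunctor j ⋙ a j ⟶ unitFunctor j ⋙ b j) {j : J} (x : W.obj j) :
    extend ha hb G ((unitFunctor j).obj x) = (G j).app x := by
  simp [extend, map_id_map]

theorem extend_push (G : ∀ j, unitFunctor j ⋙ a j ⟶ unitFunctor j ⋙ b j) {j k : J} (g : j ⟶ k)
    (x : FormalImage W j) :
    extend ha hb G (x.push g) = eqToHom (Functor.congr_obj (ha g) x) ≫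
      (X.map g).toFunctor.map (extend ha hb G x) ≫
        eqToHom (Functor.congr_obj (hb g) x).symm := by
  simp [extend, map_comp_map, eqToHom_map]

/-- By `naturality_of_unit` it suffices to test the two kinds of generators: on unit images this is
naturality of `G j`, on `unitIso` it is the modification axiom `hG`. -/
theorem extend_naturality (G : ∀ j, unitFunctor j ⋙ a j ⟶ unitFunctor j ⋙ b j)
    (hG : ∀ {i j : J} (f : i ⟶ j) (x : W.obj i),
      (G j).app ((W.map f).toFunctor.obj x) ≫
          (b j).map (unitIso f x).hom ≫ eqToHom (Functor.congr_obj (hb f) _) =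
        ((a j).map (unitIso f x).hom ≫ eqToHom (Functor.congr_obj (ha f) _)) ≫
          (X.map f).toFunctor.map ((G i).app x)) {j : J} {x y : FormalImage W j} (m : x ⟶ y) :
    (a j).map m ≫ extend ha hb G y = extend ha hb G x ≫ (b j).map m := by
  refine naturality_of_unit (extend ha hb G) (fun m => ?_) (fun f x => ?_) m
  · rw [extend_unit, extend_unit]
    exact (G j).naturality m
  · refine (congrArg _ (extend_push ha hb G f _)).trans (.trans ?_
      (congrArg (· ≫ _) (extend_unit ha hb G _).symm))
    rw [extend_unit]
    refine (Category.assoc _ _ _).symm.trans ((Category.assoc _ _ _).symm.trans ?_)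
    exact (congrArg (· ≫ _) (hG f x).symm).trans (by simp)

include ha hb in
theorem functor_ext_of_unit (hu : ∀ j, unitFunctor j ⋙ a j = unitFunctor j ⋙ b j)
    (hi : ∀ {i j : J} (f : i ⟶ j) (x : W.obj i),
      (a j).map (unitIso f x).hom ≫ eqToHom (Functor.congr_obj (ha f) _) =
        eqToHom (Functor.congr_obj (hu j) _) ≫
          ((b j).map (unitIso f x).hom ≫ eqToHom (Functor.congr_obj (hb f) _)) ≫
            eqToHom (congrArg (X.map f).toFunctor.obj (Functor.congr_obj (hu i) x).symm)) (j : J) :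
    a j = b j := by
  refine functor_ext (fun x => (obj_eq ha x).trans
    ((congrArg (X.map x.hom).toFunctor.obj (Functor.congr_obj (hu x.source) x.obj)).trans
      (obj_eq hb x).symm)) (fun m => Functor.congr_hom (hu j) m) fun {i} f x => ?_
  refine ((comp_eqToHom_iff _ _ _).1 (hi f x)).trans ?_
  simp

include ha hb in
theorem family_ext {s t : ∀ {j : J} (x : FormalImage W j), (a j).obj x ⟶ (b j).obj x}
    (hs : ∀ {i j : J} (f : i ⟶ j) (x : FormalImage W i),
      s (x.push f) = eqToHom (Functor.congr_obj (ha f) x) ≫ (X.map f).toFunctor.map (s x) ≫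
        eqToHom (Functor.congr_obj (hb f) x).symm)
    (ht : ∀ {i j : J} (f : i ⟶ j) (x : FormalImage W i),
      t (x.push f) = eqToHom (Functor.congr_obj (ha f) x) ≫ (X.map f).toFunctor.map (t x) ≫
        eqToHom (Functor.congr_obj (hb f) x).symm)
    (h : ∀ {j : J} (x : W.obj j), s ((unitFunctor j).obj x) = t ((unitFunctor j).obj x))
    {j : J} (x : FormalImage W j) : s x = t x := by
  have key : s (((unitFunctor x.source).obj x.obj).push x.hom) =
      t (((unitFunctor x.source).obj x.obj).push x.hom) := by
    rw [hs, ht, h]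
  exact x.push_unit ▸ key

end

/-- The functor on formal images induced by a pseudonatural transformation. -/
@[simps]
abbrev lift (σ : PseudoNat W X) (j : J) : FormalImage W j ⥤ X.obj j where
  obj x := (X.map x.hom).toFunctor.obj ((σ.app x.source).obj x.obj)
  map {x y} m := (σ.iso x.hom x.obj).inv ≫ (σ.app j).map m.val ≫ (σ.iso y.hom y.obj).hom
  map_id x := by simp [val]
  map_comp f g := by simp

/-- Strict on objects by functoriality of `X` alone. On morphisms, `σ.iso (f ≫ g)` splits into a
2-cell at `g` and the image of the one at `f`, and the 2-cells at `g` cancel by naturality. -/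
theorem pushFunctor_lift (σ : PseudoNat W X) {j k : J} (g : j ⟶ k) :
    pushFunctor g ⋙ lift σ k = lift σ j ⋙ (X.map g).toFunctor := by
  refine CategoryTheory.Functor.ext (fun x => map_comp_obj X _ _ _) fun x y m => ?_
  simp [PseudoNat.iso_comp, PseudoNat.iso_comp_inv, eqToHom_map, PseudoNat.iso_naturality_assoc]

/-- The 2-cells at `𝟙 j` are transports, so conjugating by them changes nothing. -/
theorem unitFunctor_lift (σ : PseudoNat W X) (j : J) : unitFunctor j ⋙ lift σ j = σ.app j := by
  refine CategoryTheory.Functor.ext (fun x => map_id_obj X _) fun x y m => ?_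
  simp [PseudoNat.iso_id, PseudoNat.iso_id_inv, eqToHom_map, map_id_map]

end FormalImage

/-- The pseudomorphism classifier of `W`. -/
def classifier : J ⥤ Cat.{u, u} where
  obj j := Cat.of (FormalImage W j)
  map g := (FormalImage.pushFunctor g).toCatHom
  map_id j := Cat.ext (FormalImage.pushFunctor_id j)
  map_comp f g := Cat.ext (FormalImage.pushFunctor_comp f g)

/-- The universal pseudonatural transformation. -/
@[simps]
def classifierUnit : PseudoNat W (classifier W) where
  app := FormalImage.unitFunctor
  iso f x := FormalImage.unitIso f x
  iso_naturality f _ _ m := FormalImage.unitIso_naturality f m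
  iso_id := FormalImage.unitIso_id
  iso_comp := FormalImage.unitIso_comp

variable {W} {X : J ⥤ Cat.{u, u}}

/-- The 2-natural transformation induced by a pseudonatural transformation. -/
def classifierLift (σ : PseudoNat W X) : classifier W ⟶ X where
  app j := (FormalImage.lift σ j).toCatHom
  naturality _ _ g := Cat.ext (FormalImage.pushFunctor_lift σ g)

theorem eqToHom_conj_comp_eqToHom {C : Type*} [Category* C] {a b c d e : C} (p : a = b)
    (f : b ⟶ c) (q : c = d) (r : d = e) :
    (eqToHom p ≫ f ≫ eqToHom q) ≫ eqToHom r = eqToHom p ≫ f ≫ eqToHom (q.trans r) := by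
  simp

theorem classifierUnit_comp_classifierLift (σ : PseudoNat W X) :
    PseudoNat.ofStrongTrans ((classifierUnit W).toStrongTrans ≫ strictTrans (classifierLift σ)) =
      σ := by
  refine PseudoNat.ext (FormalImage.unitFunctor_lift σ) fun {i j} f x => ?_
  refine (ofStrongTrans_comp_strictTrans_iso_hom _ _ f x).trans ?_
  -- The left side is the inverse 2-cell at `𝟙 j`, a transport, followed by the 2-cell at `𝟙 i ≫ f`,
  -- which agrees with that at `f`.
  have h : (FormalImage.lift σ j).map (FormalImage.unitIso f x).hom =
      eqToHom (map_id_obj X _) ≫ (σ.iso f x).hom ≫ eqToHom (by simp) := by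
    simp [PseudoNat.iso_id_inv, PseudoNat.iso_hom_of_eq σ (Category.id_comp f), eqToHom_map]
  exact (congrArg (· ≫ eqToHom _) h).trans (eqToHom_conj_comp_eqToHom _ _ _ _)

theorem classifier_naturality (α : classifier W ⟶ X) {j k : J} (g : j ⟶ k) :
    FormalImage.pushFunctor g ⋙ (α.app k).toFunctor = (α.app j).toFunctor ⋙ (X.map g).toFunctor :=
  congrArg Cat.Hom.toFunctor (α.naturality g)

theorem classifier_hom_ext {α β : classifier W ⟶ X}
    (h : (classifierUnit W).toStrongTrans ≫ strictTrans α =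
      (classifierUnit W).toStrongTrans ≫ strictTrans β) : α = β := by
  refine NatTrans.ext (funext fun j => Cat.ext ?_)
  refine FormalImage.functor_ext_of_unit (classifier_naturality α) (classifier_naturality β)
    (PseudoNat.app_congr (congrArg PseudoNat.ofStrongTrans h)) (fun f x => ?_) j
  have hi := PseudoNat.iso_congr (congrArg PseudoNat.ofStrongTrans h) f x
  rw [ofStrongTrans_comp_strictTrans_iso_hom, ofStrongTrans_comp_strictTrans_iso_hom] at hi
  exact hi

theorem classifier_modification_ext {α β : classifier W ⟶ X} {Γ Θ : strictTrans α ⟶ strictTrans β}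
    (h : (classifierUnit W).toStrongTrans ◁ Γ = (classifierUnit W).toStrongTrans ◁ Θ) :
    Γ = Θ := by
  refine Pseudofunctor.StrongTrans.homCategory.ext fun j => Cat.Hom₂.ext (NatTrans.ext (funext ?_))
  exact FormalImage.family_ext (classifier_naturality α) (classifier_naturality β)
    (s := fun {j} => (Γ.as.app ⟨j⟩).toNatTrans.app) (t := fun {j} => (Θ.as.app ⟨j⟩).toNatTrans.app)
    (strictTrans_modification_app Γ) (strictTrans_modification_app Θ) fun {j} x =>
      congrArg (fun Ξ : (classifierUnit W).toStrongTrans ≫ strictTrans α ⟶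
        (classifierUnit W).toStrongTrans ≫ strictTrans β => (Ξ.as.app ⟨j⟩).toNatTrans.app x) h

theorem exists_classifier_modification (α β : classifier W ⟶ X)
    (Γ : (classifierUnit W).toStrongTrans ≫ strictTrans α ⟶
      (classifierUnit W).toStrongTrans ≫ strictTrans β) :
    ∃ Θ : strictTrans α ⟶ strictTrans β, (classifierUnit W).toStrongTrans ◁ Θ = Γ := by
  let G (j : J) : FormalImage.unitFunctor j ⋙ (α.app j).toFunctor ⟶
    FormalImage.unitFunctor j ⋙ (β.app j).toFunctor := (Γ.as.app ⟨j⟩).toNatTrans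
  have hα {j k : J} (g : j ⟶ k) := classifier_naturality α g
  have hβ {j k : J} (g : j ⟶ k) := classifier_naturality β g
  let E (j : J) : (α.app j).toFunctor ⟶ (β.app j).toFunctor :=
    { app := FormalImage.extend hα hβ G
      naturality := fun _ _ => FormalImage.extend_naturality hα hβ G fun f x => by
        have h := modification_naturality_app Γ f x
        rw [ofStrongTrans_comp_strictTrans_iso_hom, ofStrongTrans_comp_strictTrans_iso_hom] at h
        exact h }
  refine ⟨modificationMk E fun f x => ?_, ?_⟩
  · rw [ofStrongTrans_strictTrans_iso_hom, ofStrongTrans_strictTrans_iso_hom]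
    refine (comp_eqToHom_iff (Functor.congr_obj (hβ f) x) _ _).2 ?_
    exact (FormalImage.extend_push hα hβ G f x).trans (Category.assoc _ _ _).symm
  · refine Pseudofunctor.StrongTrans.homCategory.ext fun j => Cat.Hom₂.ext (NatTrans.ext (funext ?_))
    exact FormalImage.extend_unit hα hβ G

variable (W) in
theorem isPseudomorphismClassifier_classifierUnit :
    IsPseudomorphismClassifier (classifierUnit W).toStrongTrans := fun _ =>
  ⟨⟨fun _ _ h => classifier_hom_ext h, fun σ => ⟨classifierLift (PseudoNat.ofStrongTrans σ),
    PseudoNat.equivStrongTrans.injective (classifierUnit_comp_classifierLift _)⟩⟩,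
    fun α β => ⟨fun _ _ h => classifier_modification_ext h, exists_classifier_modification α β⟩⟩

end Classifier

end CatWeight

namespace CatWeight

/-! ### A criterion for flexibility -/

section Flexible

variable {J : Type} [Category.{0} J] {W : J ⥤ Cat.{u, u}}

theorem ofStrongTrans_id_iso_inv {i j : J} (f : i ⟶ j) (x : W.obj i) :
    ((PseudoNat.ofStrongTrans (𝟙 W.toPseudofunctor')).iso f x).inv = 𝟙 _ :=
  Category.comp_id _

theorem ofStrongTrans_id_iso_hom {i j : J} (f : i ⟶ j) (x : W.obj i) :
    ((PseudoNat.ofStrongTrans (𝟙 W.toPseudofunctor')).iso f x).hom = 𝟙 _ :=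
  Category.comp_id _

/-- A weight is flexible if each of its objects is, naturally, the image of a chosen one. -/
theorem isFlexible_of_formalImage (c : ∀ {j : J}, W.obj j → FormalImage W j)
    (hc : ∀ {j : J} (x : W.obj j), (c x).val = x)
    (hc' : ∀ {i j : J} (f : i ⟶ j) (x : W.obj i),
      c ((W.map f).toFunctor.obj x) = (c x).push f) : IsFlexible W := by
  -- Morphisms of formal images are morphisms of values, so the choice on objects extends to
  -- morphisms by transport along `hc`.
  let s (j : J) : W.obj j ⥤ FormalImage W j :=
    { obj := c
      map := fun m => ⟨eqToHom (hc _) ≫ m ≫ eqToHom (hc _).symm⟩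
      map_id := fun x => FormalImage.hom_ext (by simp)
      map_comp := fun f g => FormalImage.hom_ext (by simp) }
  have hs {i j : J} (f : i ⟶ j) : (W.map f).toFunctor ⋙ s j = s i ⋙ FormalImage.pushFunctor f := by
    refine CategoryTheory.Functor.ext (hc' f) fun x y m => ?_
    ext
    simp [s, eqToHom_map]
  refine ⟨classifier W, (classifierUnit W).toStrongTrans, isPseudomorphismClassifier_classifierUnit W,
    classifierLift (PseudoNat.ofStrongTrans (𝟙 _)),
    PseudoNat.equivStrongTrans.injective (classifierUnit_comp_classifierLift _),
    { app := fun j => (s j).toCatHom, naturality := fun _ _ f => Cat.ext (hs f) }, ?_⟩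
  refine NatTrans.ext (funext fun j => Cat.ext ?_)
  have h : s j ⋙ FormalImage.lift (PseudoNat.ofStrongTrans (𝟙 W.toPseudofunctor')) j =
      𝟭 (W.obj j) := by
    refine CategoryTheory.Functor.ext hc fun x y m => ?_
    have h : (FormalImage.lift (PseudoNat.ofStrongTrans (𝟙 W.toPseudofunctor')) j).map
        ((s j).map m) = 𝟙 _ ≫ ((s j).map m).val ≫ 𝟙 _ := by
      rw [FormalImage.lift_map, ofStrongTrans_id_iso_hom, ofStrongTrans_id_iso_inv]
      rfl
    have h' : 𝟙 _ ≫ ((s j).map m).val ≫ 𝟙 _ = eqToHom (hc x) ≫ m ≫ eqToHom (hc y).symm := by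
      simp [s]
    exact h.trans h'
  exact h

end Flexible

end CatWeight

/-! ### Flexibility of `W_l` -/

namespace reflexiveLaxCodescentWeight

open CatWeight

/-- The object `[0]`. -/
abbrev point : SimplexCategory.Truncated 2 := ⟨SimplexCategory.mk 0, by simp⟩

/-- The unique object of `W_l [0]`. -/
def base : reflexiveLaxCodescentWeight.{u}.obj point := ULift.up (0 : Fin 1)

/-- The map `[0] → [n]` with a given value. -/
def vertex {n : SimplexCategory.Truncated 2} (i : reflexiveLaxCodescentWeight.{u}.obj n) :
    point ⟶ n :=
  ⟨SimplexCategory.const (SimplexCategory.mk 0) n.obj (ULift.down i)⟩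

theorem map_vertex_base {n : SimplexCategory.Truncated 2}
    (i : reflexiveLaxCodescentWeight.{u}.obj n) :
    (reflexiveLaxCodescentWeight.map (vertex i)).toFunctor.obj base = i := rfl

theorem vertex_map {m n : SimplexCategory.Truncated 2} (f : m ⟶ n)
    (i : reflexiveLaxCodescentWeight.{u}.obj m) :
    vertex ((reflexiveLaxCodescentWeight.map f).toFunctor.obj i) = vertex i ≫ f := by
  ext
  rfl

theorem isFlexible : IsFlexible reflexiveLaxCodescentWeight.{u} :=
  isFlexible_of_formalImage (fun i => ⟨point, vertex i, base⟩) map_vertex_base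
    fun f i => by simp [vertex_map, FormalImage.push]

end reflexiveLaxCodescentWeight

/-! ### The codescent object, by generators and relations -/

namespace reflexiveLaxCodescentWeight

open CatWeight

/-- The restriction of a diagram along a vertex. -/
abbrev atVertex (D : (SimplexCategory.Truncated 2)ᵒᵖ ⥤ Cat.{u, u}) {n : SimplexCategory.Truncated 2}
    (i : reflexiveLaxCodescentWeight.{u}.obj n) : D.obj (op n) ⥤ D.obj (op point) :=
  (D.map (vertex i).op).toFunctor

theorem atVertex_map_obj (D : (SimplexCategory.Truncated 2)ᵒᵖ ⥤ Cat.{u, u})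
    {k n : SimplexCategory.Truncated 2} (f : k ⟶ n) (i : reflexiveLaxCodescentWeight.{u}.obj k)
    (x : D.obj (op n)) :
    (atVertex D ((reflexiveLaxCodescentWeight.map f).toFunctor.obj i)).obj x =
      (atVertex D i).obj ((D.map f.op).toFunctor.obj x) := by
  rw [atVertex, vertex_map, op_comp, map_comp_obj]

/-- Formal composites of morphisms of `D [0]` and of the components of a cocone. -/
inductive FormalHom (D : (SimplexCategory.Truncated 2)ᵒᵖ ⥤ Cat.{u, u}) :
    D.obj (op point) → D.obj (op point) → Type u
  | mor {a b : D.obj (op point)} (f : a ⟶ b) : FormalHom D a b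
  -- Endpoints are prescribed up to a proof of equality, so that cells compose without transports.
  | cell {n : SimplexCategory.Truncated 2} {i j : reflexiveLaxCodescentWeight.{u}.obj n}
      (m : i ⟶ j) (x : D.obj (op n)) {a b : D.obj (op point)} (ha : (atVertex D i).obj x = a)
      (hb : (atVertex D j).obj x = b) : FormalHom D a b
  | comp {a b c : D.obj (op point)} (p : FormalHom D a b) (q : FormalHom D b c) : FormalHom D a c

variable {D : (SimplexCategory.Truncated 2)ᵒᵖ ⥤ Cat.{u, u}}

/-- The relations between formal composites. -/
inductive FormalHom.Rel : ∀ {a b : D.obj (op point)}, FormalHom D a b → FormalHom D a b → Prop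
  -- Congruence under composition is imposed here; the equivalence closure is supplied by `Quot`.
  | comp_left {a b c : D.obj (op point)} {p p' : FormalHom D a b} (h : FormalHom.Rel p p')
      (q : FormalHom D b c) : FormalHom.Rel (p.comp q) (p'.comp q)
  | comp_right {a b c : D.obj (op point)} (p : FormalHom D a b) {q q' : FormalHom D b c}
      (h : FormalHom.Rel q q') : FormalHom.Rel (p.comp q) (p.comp q')
  | assoc {a b c d : D.obj (op point)} (p : FormalHom D a b) (q : FormalHom D b c)
      (r : FormalHom D c d) : FormalHom.Rel ((p.comp q).comp r) (p.comp (q.comp r))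
  | id_comp {a b : D.obj (op point)} (p : FormalHom D a b) : FormalHom.Rel ((mor (𝟙 a)).comp p) p
  | comp_id {a b : D.obj (op point)} (p : FormalHom D a b) : FormalHom.Rel (p.comp (mor (𝟙 b))) p
  | mor_comp {a b c : D.obj (op point)} (f : a ⟶ b) (g : b ⟶ c) :
      FormalHom.Rel (mor (f ≫ g)) ((mor f).comp (mor g))
  | naturality {n : SimplexCategory.Truncated 2} {i j : reflexiveLaxCodescentWeight.{u}.obj n}
      (m : i ⟶ j) {x y : D.obj (op n)} (g : x ⟶ y) :
      FormalHom.Rel ((mor ((atVertex D i).map g)).comp (cell m y rfl rfl))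
        ((cell m x rfl rfl).comp (mor ((atVertex D j).map g)))
  | cell_id {n : SimplexCategory.Truncated 2} (i : reflexiveLaxCodescentWeight.{u}.obj n)
      (x : D.obj (op n)) : FormalHom.Rel (cell (𝟙 i) x rfl rfl) (mor (𝟙 ((atVertex D i).obj x)))
  | cell_comp {n : SimplexCategory.Truncated 2} {i j k : reflexiveLaxCodescentWeight.{u}.obj n}
      (m : i ⟶ j) (m' : j ⟶ k) (x : D.obj (op n)) :
      FormalHom.Rel (cell (m ≫ m') x rfl rfl) ((cell m x rfl rfl).comp (cell m' x rfl rfl))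
  | cell_map {k n : SimplexCategory.Truncated 2} (f : k ⟶ n)
      {i j : reflexiveLaxCodescentWeight.{u}.obj k} (m : i ⟶ j) (x : D.obj (op n)) :
      FormalHom.Rel (cell ((reflexiveLaxCodescentWeight.map f).toFunctor.map m) x rfl rfl)
        (cell m ((D.map f.op).toFunctor.obj x) (atVertex_map_obj D f i x).symm
          (atVertex_map_obj D f j x).symm)

variable (D) in
/-- The reflexive lax codescent object of `D`. -/
structure Codescent : Type u where
  /-- The underlying object. -/
  as : D.obj (op point)

namespace Codescent

/-- Morphisms are formal composites up to the relations. -/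
def Hom (a b : Codescent D) : Type u := Quot (FormalHom.Rel (a := a.as) (b := b.as))

instance : Category.{u} (Codescent D) where
  Hom := Hom
  id a := Quot.mk _ (.mor (𝟙 a.as))
  comp := Quot.map₂ .comp (fun p _ _ h => .comp_right p h) (fun _ _ q h => .comp_left h q)
  id_comp := by
    rintro a b ⟨p⟩
    exact Quot.sound (.id_comp p)
  comp_id := by
    rintro a b ⟨p⟩
    exact Quot.sound (.comp_id p)
  assoc := by
    rintro a b c d ⟨p⟩ ⟨q⟩ ⟨r⟩
    exact Quot.sound (.assoc p q r)

variable (D) in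
/-- The inclusion of `D [0]`. -/
abbrev incl : D.obj (op point) ⥤ Codescent D where
  obj x := ⟨x⟩
  map f := Quot.mk _ (.mor f)
  map_id _ := rfl
  map_comp f g := Quot.sound (.mor_comp f g)

variable (D) in
/-- The components of the universal cocone. -/
def cell {n : SimplexCategory.Truncated 2} {i j : reflexiveLaxCodescentWeight.{u}.obj n}
    (m : i ⟶ j) : atVertex D i ⋙ incl D ⟶ atVertex D j ⋙ incl D where
  app x := Quot.mk _ (.cell m x rfl rfl)
  naturality _ _ g := Quot.sound (.naturality m g)

theorem mk_cell {n : SimplexCategory.Truncated 2} {i j : reflexiveLaxCodescentWeight.{u}.obj n}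
    (m : i ⟶ j) (x : D.obj (op n)) {a b : D.obj (op point)} (ha : (atVertex D i).obj x = a)
    (hb : (atVertex D j).obj x = b) :
    (Quot.mk _ (.cell m x ha hb) : (⟨a⟩ : Codescent D) ⟶ ⟨b⟩) =
      eqToHom (congrArg mk ha.symm) ≫ (cell D m).app x ≫ eqToHom (congrArg mk hb) := by
  subst ha hb
  exact ((Category.id_comp _).trans (Category.comp_id ((cell D m).app x))).symm

theorem cell_id {n : SimplexCategory.Truncated 2} (i : reflexiveLaxCodescentWeight.{u}.obj n) :
    cell D (𝟙 i) = 𝟙 _ :=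
  NatTrans.ext (funext fun x => Quot.sound (.cell_id i x))

theorem cell_comp {n : SimplexCategory.Truncated 2} {i j k : reflexiveLaxCodescentWeight.{u}.obj n}
    (m : i ⟶ j) (m' : j ⟶ k) : cell D (m ≫ m') = cell D m ≫ cell D m' :=
  NatTrans.ext (funext fun x => Quot.sound (.cell_comp m m' x))

theorem cell_map {k n : SimplexCategory.Truncated 2} (f : k ⟶ n)
    {i j : reflexiveLaxCodescentWeight.{u}.obj k} (m : i ⟶ j) (x : D.obj (op n)) :
    (cell D ((reflexiveLaxCodescentWeight.map f).toFunctor.map m)).app x =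
      eqToHom (congrArg mk (atVertex_map_obj D f i x)) ≫
        (cell D m).app ((D.map f.op).toFunctor.obj x) ≫
          eqToHom (congrArg mk (atVertex_map_obj D f j x).symm) :=
  (Quot.sound (.cell_map f m x)).trans (mk_cell _ _ _ _)

/-- Morphisms of the codescent object are generated by those of `D [0]` and the components of
the universal cocone. -/
theorem hom_induction {P : ∀ {a b : Codescent D}, (a ⟶ b) → Prop}
    (mor : ∀ {x y : D.obj (op point)} (f : x ⟶ y), P ((incl D).map f))
    (cell : ∀ {n : SimplexCategory.Truncated 2} {i j : reflexiveLaxCodescentWeight.{u}.obj n}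
      (m : i ⟶ j) (x : D.obj (op n)), P ((cell D m).app x))
    (comp : ∀ {a b c : Codescent D} (f : a ⟶ b) (g : b ⟶ c), P f → P g → P (f ≫ g))
    {a b : Codescent D} (f : a ⟶ b) : P f := by
  obtain ⟨a⟩ := a
  obtain ⟨b⟩ := b
  obtain ⟨p : FormalHom D a b⟩ := f
  clear f
  induction p with
  | mor f => exact mor f
  | cell m x ha hb =>
    subst ha hb
    exact cell m x
  | comp p q hp hq => exact comp _ _ hp hq

theorem functor_ext {A : Type*} [Category* A] {F G : Codescent D ⥤ A}
    (ho : ∀ x, F.obj ⟨x⟩ = G.obj ⟨x⟩)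
    (hm : ∀ {x y : D.obj (op point)} (f : x ⟶ y), F.map ((incl D).map f) =
      eqToHom (ho x) ≫ G.map ((incl D).map f) ≫ eqToHom (ho y).symm)
    (hc : ∀ {n : SimplexCategory.Truncated 2} {i j : reflexiveLaxCodescentWeight.{u}.obj n}
      (m : i ⟶ j) (x : D.obj (op n)), F.map ((cell D m).app x) =
        eqToHom (ho _) ≫ G.map ((cell D m).app x) ≫ eqToHom (ho _).symm) : F = G :=
  CategoryTheory.Functor.ext (fun a => ho a.as) fun a b f => by
    induction f using hom_induction with
    | mor f => exact hm f
    | cell m x => exact hc m x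
    | comp f g hf hg => simp [hf, hg]

theorem natural_of_generators {A : Type*} [Category* A] {F G : Codescent D ⥤ A}
    (t : ∀ x, F.obj x ⟶ G.obj x)
    (hm : ∀ {x y : D.obj (op point)} (f : x ⟶ y), F.map ((incl D).map f) ≫ t _ =
      t _ ≫ G.map ((incl D).map f))
    (hc : ∀ {n : SimplexCategory.Truncated 2} {i j : reflexiveLaxCodescentWeight.{u}.obj n}
      (m : i ⟶ j) (x : D.obj (op n)), F.map ((cell D m).app x) ≫ t _ =
        t _ ≫ G.map ((cell D m).app x)) {a b : Codescent D} (f : a ⟶ b) :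
    F.map f ≫ t b = t a ≫ G.map f := by
  induction f using hom_induction with
  | mor f => exact hm f
  | cell m x => exact hc m x
  | comp f g hf hg => rw [F.map_comp, G.map_comp, Category.assoc, hg, reassoc_of% hf]

end Codescent

variable (D) in
/-- Cocones under `D`, weighted by `W_l`. -/
structure Cocone (A : Type*) [Category* A] where
  /-- The component at `[0]`. -/
  functor : D.obj (op point) ⥤ A
  /-- The components at the morphisms of `[n]`. -/
  cell {n : SimplexCategory.Truncated 2} {i j : reflexiveLaxCodescentWeight.{u}.obj n} (m : i ⟶ j)
    (x : D.obj (op n)) : functor.obj ((atVertex D i).obj x) ⟶ functor.obj ((atVertex D j).obj x)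
  cell_naturality {n : SimplexCategory.Truncated 2} {i j : reflexiveLaxCodescentWeight.{u}.obj n}
    (m : i ⟶ j) {x y : D.obj (op n)} (g : x ⟶ y) :
    functor.map ((atVertex D i).map g) ≫ cell m y = cell m x ≫ functor.map ((atVertex D j).map g)
  cell_id {n : SimplexCategory.Truncated 2} (i : reflexiveLaxCodescentWeight.{u}.obj n)
    (x : D.obj (op n)) : cell (𝟙 i) x = 𝟙 _
  cell_comp {n : SimplexCategory.Truncated 2} {i j k : reflexiveLaxCodescentWeight.{u}.obj n}
    (m : i ⟶ j) (m' : j ⟶ k) (x : D.obj (op n)) : cell (m ≫ m') x = cell m x ≫ cell m' x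
  cell_map {k n : SimplexCategory.Truncated 2} (f : k ⟶ n)
    {i j : reflexiveLaxCodescentWeight.{u}.obj k} (m : i ⟶ j) (x : D.obj (op n)) :
    cell ((reflexiveLaxCodescentWeight.map f).toFunctor.map m) x =
      eqToHom (congrArg functor.obj (atVertex_map_obj D f i x)) ≫
        cell m ((D.map f.op).toFunctor.obj x) ≫
          eqToHom (congrArg functor.obj (atVertex_map_obj D f j x).symm)

namespace Cocone

variable {A : Type*} [Category* A] (c : Cocone D A)

/-- The value of the induced functor on formal composites. -/
def mapFormal : ∀ {a b : D.obj (op point)}, FormalHom D a b → (c.functor.obj a ⟶ c.functor.obj b)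
  | _, _, .mor f => c.functor.map f
  | _, _, .cell m x ha hb => eqToHom (congrArg c.functor.obj ha.symm) ≫ c.cell m x ≫
      eqToHom (congrArg c.functor.obj hb)
  | _, _, .comp p q => mapFormal p ≫ mapFormal q

theorem mapFormal_eq {a b : D.obj (op point)} {p q : FormalHom D a b} (h : p.Rel q) :
    c.mapFormal p = c.mapFormal q := by
  induction h with
  | comp_left h q ih => simp only [mapFormal, ih]
  | comp_right p h ih => simp only [mapFormal, ih]
  | assoc p q r => simp only [mapFormal, Category.assoc]
  | id_comp p => simp [mapFormal]
  | comp_id p => simp [mapFormal]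
  | mor_comp f g => simp [mapFormal]
  | naturality m g => simp [mapFormal, c.cell_naturality]
  | cell_id i x => simp [mapFormal, c.cell_id]
  | cell_comp m m' x => simp [mapFormal, c.cell_comp]
  | cell_map f m x => simp [mapFormal, c.cell_map]

/-- The functor induced by a cocone. -/
abbrev desc : Codescent D ⥤ A where
  obj a := c.functor.obj a.as
  map := Quot.lift c.mapFormal fun _ _ h => c.mapFormal_eq h
  map_id a := c.functor.map_id a.as
  map_comp := by
    rintro a b d ⟨p⟩ ⟨q⟩
    rfl

@[simp]
theorem desc_map_cell {n : SimplexCategory.Truncated 2}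
    {i j : reflexiveLaxCodescentWeight.{u}.obj n} (m : i ⟶ j) (x : D.obj (op n)) :
    c.desc.map ((Codescent.cell D m).app x) = c.cell m x :=
  (Category.id_comp _).trans (Category.comp_id _)

end Cocone

end reflexiveLaxCodescentWeight

/-! ### The universal property of the codescent object -/

namespace reflexiveLaxCodescentWeight

open CatWeight

variable {D : (SimplexCategory.Truncated 2)ᵒᵖ ⥤ Cat.{u, u}}

theorem atVertex_base : atVertex D base = 𝟭 (D.obj (op point)) := by
  have h : vertex base = 𝟙 point := by
    ext i
    exact congrArg Fin.val (Subsingleton.elim (α := Fin 1) _ _)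
  rw [atVertex, h, op_id, D.map_id]
  rfl

theorem atVertex_map {k n : SimplexCategory.Truncated 2} (f : k ⟶ n)
    (i : reflexiveLaxCodescentWeight.{u}.obj k) :
    atVertex D ((reflexiveLaxCodescentWeight.map f).toFunctor.obj i) =
      (D.map f.op).toFunctor ⋙ atVertex D i := by
  rw [atVertex, vertex_map, op_comp, D.map_comp]
  rfl

namespace Codescent

variable (D) in
/-- The components of the universal cocone. -/
abbrev universal (n : SimplexCategory.Truncated 2) :
    reflexiveLaxCodescentWeight.{u}.obj n ⥤ D.obj (op n) ⥤ Codescent D where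
  obj i := atVertex D i ⋙ incl D
  map m := cell D m
  map_id := cell_id
  map_comp := cell_comp

theorem universal_naturality {k n : SimplexCategory.Truncated 2} (f : k ⟶ n) :
    (reflexiveLaxCodescentWeight.map f).toFunctor ⋙ universal D n =
      universal D k ⋙ (Functor.whiskeringLeft _ _ _).obj (D.map f.op).toFunctor := by
  refine CategoryTheory.Functor.ext
    (fun i => congrArg (· ⋙ incl D) (atVertex_map f i)) fun i j m => ?_
  ext x
  simp [cell_map]

variable (D) in
/-- The universal cocone. -/
def universalCocone : reflexiveLaxCodescentWeight ⟶ homFunctor D (Cat.of (Codescent D)) where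
  app n := (universal D n).toCatHom
  naturality _ _ f := Cat.ext (universal_naturality f)

end Codescent

section Family

variable {A : Type*} [Category* A]
  {e : ∀ n : SimplexCategory.Truncated 2,
    reflexiveLaxCodescentWeight.{u}.obj n ⥤ D.obj (op n) ⥤ A}
  (he : ∀ {k n : SimplexCategory.Truncated 2} (f : k ⟶ n),
    (reflexiveLaxCodescentWeight.map f).toFunctor ⋙ e n =
      e k ⋙ (Functor.whiskeringLeft _ _ _).obj (D.map f.op).toFunctor)

include he in
-- Naturality along `vertex i : [0] ⟶ [n]`: a cocone is determined on objects by its component at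
-- `[0]`, which is why `Cocone` records just one functor.
theorem family_obj_eq {n : SimplexCategory.Truncated 2}
    (i : reflexiveLaxCodescentWeight.{u}.obj n) :
    (e n).obj i = atVertex D i ⋙ (e point).obj base :=
  Functor.congr_obj (he (vertex i)) base

/-- The cocone with given components. -/
abbrev Cocone.ofFamily : Cocone D A where
  functor := (e point).obj base
  cell {n i j} m x := eqToHom (Functor.congr_obj (family_obj_eq he i) x).symm ≫
    ((e n).map m).app x ≫ eqToHom (Functor.congr_obj (family_obj_eq he j) x)
  cell_naturality {n i j} m x y g := by
    have hi := Functor.congr_hom (family_obj_eq he i) g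
    have hj := Functor.congr_hom (family_obj_eq he j) g
    have h := ((e n).map m).naturality g
    rw [hi, hj] at h
    simpa using eqToHom (Functor.congr_obj (family_obj_eq he i) x).symm ≫= h =≫
      eqToHom (Functor.congr_obj (family_obj_eq he j) y)
  cell_id i x := by simp
  cell_comp m m' x := by simp
  cell_map {k n} f {i j} m x := by
    have h := NatTrans.congr_app (Functor.congr_hom (he f) m) x
    simp at h
    simp [h]

/-- The existence half of the one-dimensional universal property. -/
theorem universal_comp_desc (n : SimplexCategory.Truncated 2) :
    Codescent.universal D n ⋙ (Functor.whiskeringRight _ _ _).obj (Cocone.ofFamily he).desc =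
      e n := by
  refine CategoryTheory.Functor.ext (fun i => (family_obj_eq he i).symm) fun i j m => ?_
  ext x
  have h := (Cocone.ofFamily he).desc_map_cell m x
  exact h.trans (congrArg₂ (fun p q => p ≫ ((e n).map m).app x ≫ q)
    (eqToHom_app (family_obj_eq he i).symm x).symm (eqToHom_app (family_obj_eq he j) x).symm)

/-- The uniqueness half: the universal cocone contains all the generators, the morphisms of `D [0]`
occurring through its component at `base`. -/
theorem functor_ext_of_universal {F G : Codescent D ⥤ A}
    (h : ∀ n, Codescent.universal D n ⋙ (Functor.whiskeringRight _ _ _).obj F =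
      Codescent.universal D n ⋙ (Functor.whiskeringRight _ _ _).obj G) : F = G := by
  have hi : Codescent.incl D ⋙ F = Codescent.incl D ⋙ G := by
    have hb : atVertex D base ⋙ Codescent.incl D ⋙ F = atVertex D base ⋙ Codescent.incl D ⋙ G :=
      Functor.congr_obj (h point) base
    rw [atVertex_base] at hb
    exact hb
  refine Codescent.functor_ext (Functor.congr_obj hi) (Functor.congr_hom hi) fun m x => ?_
  simpa using NatTrans.congr_app (Functor.congr_hom (h _) m) x

end Family

section Modifications

variable {A : Type*} [Category* A] {F G : Codescent D ⥤ A}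

theorem codescent_natTrans_ext {η θ : F ⟶ G}
    (h : ∀ x : D.obj (op point), η.app ⟨(atVertex D base).obj x⟩ = θ.app ⟨(atVertex D base).obj x⟩) :
    η = θ := by
  rw [atVertex_base] at h
  exact NatTrans.ext (funext fun x => h x.as)

theorem exists_codescent_natTrans
    (t : ∀ n, Codescent.universal D n ⋙ (Functor.whiskeringRight _ _ _).obj F ⟶
      Codescent.universal D n ⋙ (Functor.whiskeringRight _ _ _).obj G)
    (ht : ∀ {k n : SimplexCategory.Truncated 2} (f : k ⟶ n)
      (i : reflexiveLaxCodescentWeight.{u}.obj k) (x : D.obj (op n)),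
      ((t n).app ((reflexiveLaxCodescentWeight.map f).toFunctor.obj i)).app x =
        eqToHom (congrArg (fun z => F.obj ⟨z⟩) (atVertex_map_obj D f i x)) ≫
          ((t k).app i).app ((D.map f.op).toFunctor.obj x) ≫
            eqToHom (congrArg (fun z => G.obj ⟨z⟩) (atVertex_map_obj D f i x).symm)) :
    ∃ η : F ⟶ G, ∀ (n : SimplexCategory.Truncated 2) (i : reflexiveLaxCodescentWeight.{u}.obj n)
      (x : D.obj (op n)), ((t n).app i).app x = η.app ⟨(atVertex D i).obj x⟩ := by
  have hb (H : Codescent D ⥤ A) :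
      Codescent.incl D ⋙ H = atVertex D base ⋙ Codescent.incl D ⋙ H := by
    rw [atVertex_base]
    rfl
  -- The component of `t` at the only object of `[0]`; by `hs` every other component is its
  -- restriction along a vertex. Naturality on cells is then naturality of `t n` along the morphisms
  -- of `[n]`.
  let s : Codescent.incl D ⋙ F ⟶ Codescent.incl D ⋙ G :=
    eqToHom (hb F) ≫ (t point).app base ≫ eqToHom (hb G).symm
  have hs {n : SimplexCategory.Truncated 2} (i : reflexiveLaxCodescentWeight.{u}.obj n)
      (x : D.obj (op n)) : ((t n).app i).app x = s.app ((atVertex D i).obj x) :=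
    (ht (vertex i) base x).trans (congrArg₂ (fun p q => p ≫ ((t point).app base).app _ ≫ q)
      (eqToHom_app (hb F) _).symm (eqToHom_app (hb G).symm _).symm)
  have nat {a b : Codescent D} (f : a ⟶ b) : F.map f ≫ s.app b.as = s.app a.as ≫ G.map f := by
    refine Codescent.natural_of_generators (fun a => s.app a.as) (fun f => s.naturality f)
      (fun m x => ?_) f
    refine (congrArg _ (hs _ _).symm).trans (.trans ?_ (congrArg (· ≫ _) (hs _ _)))
    exact NatTrans.congr_app ((t _).naturality m) x
  exact ⟨{ app := fun a => s.app a.as, naturality := fun _ _ => nat }, fun n i x => hs i x⟩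

end Modifications

theorem isWeightedColimit_universalCocone :
    IsWeightedColimit (Codescent.universalCocone D) := by
  refine fun A => ⟨⟨fun F G h => ?_, fun γ => ?_⟩, fun F G => ⟨fun η θ h => ?_, fun Γ => ?_⟩⟩
  · exact Cat.ext (functor_ext_of_universal fun n =>
      congrArg (fun α : reflexiveLaxCodescentWeight ⟶ homFunctor D A => (α.app n).toFunctor) h)
  · refine ⟨(Cocone.ofFamily (e := fun n => (γ.app n).toFunctor)
      fun f => congrArg Cat.Hom.toFunctor (γ.naturality f)).desc.toCatHom, ?_⟩
    exact NatTrans.ext (funext fun n => Cat.ext (universal_comp_desc _ n))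
  · refine Cat.Hom₂.ext (codescent_natTrans_ext fun x => ?_)
    have := congrArg (fun Ξ : strictTrans (Codescent.universalCocone D) ≫ strictTrans (homPost D F) ⟶
      strictTrans (Codescent.universalCocone D) ≫ strictTrans (homPost D G) =>
        ((Ξ.as.app ⟨point⟩).toNatTrans.app base)) h
    exact NatTrans.congr_app this x
  · obtain ⟨η, hη⟩ := exists_codescent_natTrans (F := F.toFunctor) (G := G.toFunctor)
      (fun n => (Γ.as.app ⟨n⟩).toNatTrans) fun f i x => by
        refine (NatTrans.congr_app (strictTrans_comp_modification_app Γ f i) x).trans ?_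
        exact congrArg₂ (fun p q => p ≫ _ ≫ q) (eqToHom_app _ _) (eqToHom_app _ _)
    refine ⟨⟨η⟩, Pseudofunctor.StrongTrans.homCategory.ext fun n => Cat.Hom₂.ext (NatTrans.ext
      (funext fun i => NatTrans.ext (funext fun x => (hη n.as i x).symm)))⟩

end reflexiveLaxCodescentWeight

/-! ### Functoriality of the codescent object -/

namespace reflexiveLaxCodescentWeight

open CatWeight

variable {D E : (SimplexCategory.Truncated 2)ᵒᵖ ⥤ Cat.{u, u}}

namespace Codescent

variable (D) in
/-- The class of a component of the universal cocone, with given endpoints. -/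
def cellAt {n : SimplexCategory.Truncated 2} {i j : reflexiveLaxCodescentWeight.{u}.obj n}
    (m : i ⟶ j) (x : D.obj (op n)) {a b : D.obj (op point)} (ha : (atVertex D i).obj x = a)
    (hb : (atVertex D j).obj x = b) : (incl D).obj a ⟶ (incl D).obj b :=
  Quot.mk _ (.cell m x ha hb)

theorem cellAt_eq {n : SimplexCategory.Truncated 2} {i j : reflexiveLaxCodescentWeight.{u}.obj n}
    (m : i ⟶ j) (x : D.obj (op n)) {a b : D.obj (op point)} (ha : (atVertex D i).obj x = a)
    (hb : (atVertex D j).obj x = b) : cellAt D m x ha hb =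
      eqToHom (congrArg mk ha.symm) ≫ (cell D m).app x ≫ eqToHom (congrArg mk hb) :=
  mk_cell m x ha hb

theorem cellAt_id {n : SimplexCategory.Truncated 2} (i : reflexiveLaxCodescentWeight.{u}.obj n)
    (x : D.obj (op n)) {a : D.obj (op point)} (ha ha' : (atVertex D i).obj x = a) :
    cellAt D (𝟙 i) x ha ha' = 𝟙 _ := by
  subst ha
  exact Quot.sound (.cell_id i x)

theorem cellAt_comp {n : SimplexCategory.Truncated 2}
    {i j k : reflexiveLaxCodescentWeight.{u}.obj n} (m : i ⟶ j) (m' : j ⟶ k) (x : D.obj (op n))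
    {a b c : D.obj (op point)} (ha : (atVertex D i).obj x = a) (hb : (atVertex D j).obj x = b)
    (hc : (atVertex D k).obj x = c) :
    cellAt D m x ha hb ≫ cellAt D m' x hb hc = cellAt D (m ≫ m') x ha hc := by
  subst ha hb hc
  exact (Quot.sound (.cell_comp m m' x)).symm

theorem cellAt_map {k n : SimplexCategory.Truncated 2} (f : k ⟶ n)
    {i j : reflexiveLaxCodescentWeight.{u}.obj k} (m : i ⟶ j) (x : D.obj (op n))
    {a b : D.obj (op point)}
    (ha : (atVertex D ((reflexiveLaxCodescentWeight.map f).toFunctor.obj i)).obj x = a)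
    (hb : (atVertex D ((reflexiveLaxCodescentWeight.map f).toFunctor.obj j)).obj x = b) :
    cellAt D ((reflexiveLaxCodescentWeight.map f).toFunctor.map m) x ha hb =
      cellAt D m ((D.map f.op).toFunctor.obj x) ((atVertex_map_obj D f i x).symm.trans ha)
        ((atVertex_map_obj D f j x).symm.trans hb) := by
  subst ha hb
  exact Quot.sound (.cell_map f m x)

theorem cellAt_congr {n : SimplexCategory.Truncated 2}
    {i j : reflexiveLaxCodescentWeight.{u}.obj n} (m : i ⟶ j) {x y : D.obj (op n)} (h : x = y)
    {a b : D.obj (op point)} (ha : (atVertex D i).obj x = a) (hb : (atVertex D j).obj x = b) :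
    cellAt D m x ha hb = cellAt D m y (h ▸ ha) (h ▸ hb) := by
  subst h
  rfl

theorem cellAt_naturality {n : SimplexCategory.Truncated 2}
    {i j : reflexiveLaxCodescentWeight.{u}.obj n} (m : i ⟶ j) {x y : D.obj (op n)} (g : x ⟶ y)
    {a b a' b' : D.obj (op point)} (ha : (atVertex D i).obj x = a) (hb : (atVertex D j).obj x = b)
    (ha' : (atVertex D i).obj y = a') (hb' : (atVertex D j).obj y = b') (u : a ⟶ a') (v : b ⟶ b')
    (hu : (atVertex D i).map g = eqToHom ha ≫ u ≫ eqToHom ha'.symm)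
    (hv : (atVertex D j).map g = eqToHom hb ≫ v ≫ eqToHom hb'.symm) :
    (incl D).map u ≫ cellAt D m y ha' hb' = cellAt D m x ha hb ≫ (incl D).map v := by
  subst ha hb ha' hb'
  simp only [eqToHom_refl, Category.id_comp, Category.comp_id] at hu hv
  subst hu hv
  exact (cell D m).naturality g

variable (D E) in
/-- The cocone defining the action of the codescent object functor. -/
abbrev mapCocone (t : D ⟶ E) : Cocone D (Codescent E) where
  functor := (t.app (op point)).toFunctor ⋙ incl E
  cell {n i j} m x := cellAt E m ((t.app (op n)).toFunctor.obj x)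
    (naturality_obj t (vertex i).op x).symm (naturality_obj t (vertex j).op x).symm
  cell_naturality {n i j} m x y g := cellAt_naturality m ((t.app (op n)).toFunctor.map g) _ _ _ _ _ _
    (by simp [naturality_map t]) (by simp [naturality_map t])
  cell_id i x := cellAt_id i _ _ _
  cell_comp m m' x := (cellAt_comp m m' _ _ _ _).symm
  cell_map {k n} f {i j} m x := by
    rw [cellAt_map, cellAt_congr _ (naturality_obj t f.op x).symm]
    simp [cellAt_eq]

/-- The action of the codescent object functor. -/
abbrev map (t : D ⟶ E) : Codescent D ⥤ Codescent E := (mapCocone D E t).desc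

/-- Naturality of the universal cocone in the diagram. It characterizes `map t`, so that `map_id`
and `map_comp` follow from uniqueness. -/
theorem universal_comp_map (t : D ⟶ E) (n : SimplexCategory.Truncated 2) :
    universal D n ⋙ (Functor.whiskeringRight _ _ _).obj (map t) =
      universal E n ⋙ (Functor.whiskeringLeft _ _ _).obj (t.app (op n)).toFunctor := by
  have ho (i : reflexiveLaxCodescentWeight.{u}.obj n) : atVertex D i ⋙ incl D ⋙ map t =
      (t.app (op n)).toFunctor ⋙ atVertex E i ⋙ incl E :=
    congrArg (fun s : D.obj (op n) ⟶ E.obj (op point) => s.toFunctor ⋙ incl E)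
      (t.naturality (vertex i).op)
  refine CategoryTheory.Functor.ext ho fun i j m => ?_
  ext x
  refine ((mapCocone D E t).desc_map_cell m x).trans ((cellAt_eq _ _ _ _).trans ?_)
  exact congrArg₂ (fun p q => p ≫ (cell E m).app _ ≫ q) (eqToHom_app (ho i) x).symm
    (eqToHom_app (ho j).symm x).symm

variable (D) in
theorem map_id : map (𝟙 D) = 𝟭 (Codescent D) :=
  functor_ext_of_universal (universal_comp_map (𝟙 D))

theorem map_comp {F : (SimplexCategory.Truncated 2)ᵒᵖ ⥤ Cat.{u, u}} (t : D ⟶ E) (s : E ⟶ F) :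
    map (t ≫ s) = map t ⋙ map s := by
  refine functor_ext_of_universal fun n => (universal_comp_map (t ≫ s) n).trans (.symm ?_)
  refine (congrArg (· ⋙ (Functor.whiskeringRight _ _ _).obj (map s)) (universal_comp_map t n)).trans ?_
  exact congrArg (· ⋙ (Functor.whiskeringLeft _ _ _).obj (t.app (op n)).toFunctor)
    (universal_comp_map s n)

end Codescent

/-- The reflexive lax codescent object functor. -/
def codescentFunctor : ((SimplexCategory.Truncated 2)ᵒᵖ ⥤ Cat.{u, u}) ⥤ Cat.{u, u} where
  obj D := Cat.of (Codescent D)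
  map t := (Codescent.map t).toCatHom
  map_id D := Cat.ext (Codescent.map_id D)
  map_comp t s := Cat.ext (Codescent.map_comp t s)

/-- Codescent objects are the colimits weighted by `W_l`. -/
def weightedColimitFunctor :
    WeightedColimitFunctor reflexiveLaxCodescentWeight.{u} codescentFunctor where
  cocone := Codescent.universalCocone
  isWeightedColimit _ := isWeightedColimit_universalCocone
  naturality t := NatTrans.ext (funext fun n => Cat.ext (Codescent.universal_comp_map t n))

end reflexiveLaxCodescentWeight

/-! ### Products of diagrams, and the cocones fixing one factor -/

namespace reflexiveLaxCodescentWeight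

open CatWeight

variable {D E : (SimplexCategory.Truncated 2)ᵒᵖ ⥤ Cat.{u, u}}

instance (n : SimplexCategory.Truncated 2) : Unique (n ⟶ point) where
  default := ⟨SimplexCategory.const n.obj (SimplexCategory.mk 0) 0⟩
  uniq _ := ObjectProperty.hom_ext _ (Subsingleton.elim (α := n.obj ⟶ SimplexCategory.mk 0) _ _)

variable (E) in
/-- Degenerate simplices. -/
abbrev degenerate (n : SimplexCategory.Truncated 2) : E.obj (op point) ⥤ E.obj (op n) :=
  (E.map (default : n ⟶ point).op).toFunctor

/-- `[0]` is terminal, so restricting a totally degenerate simplex leaves it totally degenerate.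
This compatibility makes pairing with degenerate simplices a cocone. -/
theorem map_degenerate {k n : SimplexCategory.Truncated 2} (f : k ⟶ n) (e : E.obj (op point)) :
    (E.map f.op).toFunctor.obj ((degenerate E n).obj e) = (degenerate E k).obj e := by
  rw [← map_comp_obj, ← op_comp, Subsingleton.elim (f ≫ default) default]

theorem atVertex_degenerate {n : SimplexCategory.Truncated 2}
    (i : reflexiveLaxCodescentWeight.{u}.obj n) (e : E.obj (op point)) :
    (atVertex E i).obj ((degenerate E n).obj e) = e := by
  rw [map_degenerate, degenerate, Subsingleton.elim default (𝟙 point), op_id, map_id_obj]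

theorem atVertex_degenerate_map {n : SimplexCategory.Truncated 2}
    (i : reflexiveLaxCodescentWeight.{u}.obj n) {e e' : E.obj (op point)} (g : e ⟶ e') :
    (atVertex E i).map ((degenerate E n).map g) =
      eqToHom (atVertex_degenerate i e) ≫ g ≫ eqToHom (atVertex_degenerate i e').symm := by
  have h : degenerate E n ⋙ atVertex E i = 𝟭 _ := by
    have h' : E.map (default : n ⟶ point).op ≫ E.map (vertex i).op = 𝟙 _ := by
      rw [← E.map_comp, ← op_comp, Subsingleton.elim (vertex i ≫ default) (𝟙 point), op_id, E.map_id]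
    exact congrArg Cat.Hom.toFunctor h'
  exact Functor.congr_hom h g

variable (D E) in
/-- The product of two diagrams. -/
abbrev prodDiagram : (SimplexCategory.Truncated 2)ᵒᵖ ⥤ Cat.{u, u} where
  obj n := Cat.of (D.obj n × E.obj n)
  map f := ((D.map f).toFunctor.prod (E.map f).toFunctor).toCatHom
  map_id n := by
    rw [D.map_id, E.map_id]
    rfl
  map_comp f g := by
    rw [D.map_comp, E.map_comp]
    rfl

variable (D E) in
/-- The first projection. -/
abbrev fstDiagram : prodDiagram D E ⟶ D where
  app n := (CategoryTheory.Prod.fst (D.obj n) (E.obj n)).toCatHom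

variable (D E) in
/-- The second projection. -/
abbrev sndDiagram : prodDiagram D E ⟶ E where
  app n := (CategoryTheory.Prod.snd (D.obj n) (E.obj n)).toCatHom

/-- The pairing of two maps of diagrams. -/
abbrev liftDiagram {T : (SimplexCategory.Truncated 2)ᵒᵖ ⥤ Cat.{u, u}} (s : T ⟶ D) (t : T ⟶ E) :
    T ⟶ prodDiagram D E where
  app n := ((s.app n).toFunctor.prod' (t.app n).toFunctor).toCatHom
  naturality _ _ f := congrArg₂ (fun F G => (Functor.prod' F G).toCatHom)
    (congrArg Cat.Hom.toFunctor (s.naturality f)) (congrArg Cat.Hom.toFunctor (t.naturality f))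

variable (D E) in
/-- `prodDiagram` is a product. -/
def isLimitProdDiagram : IsLimit (BinaryFan.mk (fstDiagram D E) (sndDiagram D E)) :=
  BinaryFan.isLimitMk (fun s => liftDiagram s.fst s.snd) (fun _ => rfl) (fun _ => rfl)
    fun s m hs ht => by
      rw [← hs, ← ht]
      rfl

namespace Codescent

section PairCell

variable {n : SimplexCategory.Truncated 2} {i j : reflexiveLaxCodescentWeight.{u}.obj n}
  (m : i ⟶ j) (x : D.obj (op n)) (y : E.obj (op n)) {a b : D.obj (op point)}
  {c d : E.obj (op point)} (ha : (atVertex D i).obj x = a) (hb : (atVertex D j).obj x = b)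
  (hc : (atVertex E i).obj y = c) (hd : (atVertex E j).obj y = d)

/-- Components of the universal cocone under a product. -/
def pairCell : (incl (prodDiagram D E)).obj (a, c) ⟶ (incl (prodDiagram D E)).obj (b, d) :=
  cellAt (prodDiagram D E) m (x, y) (Prod.ext ha hc) (Prod.ext hb hd)

theorem pairCell_id (ha' : (atVertex D i).obj x = a) (hc' : (atVertex E i).obj y = c) :
    pairCell (𝟙 i) x y ha ha' hc hc' = 𝟙 _ :=
  cellAt_id i _ _ _

theorem pairCell_comp {k : reflexiveLaxCodescentWeight.{u}.obj n} (m' : j ⟶ k)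
    {b' : D.obj (op point)} {d' : E.obj (op point)} (hb' : (atVertex D k).obj x = b')
    (hd' : (atVertex E k).obj y = d') :
    pairCell m x y ha hb hc hd ≫ pairCell m' x y hb hb' hd hd' =
      pairCell (m ≫ m') x y ha hb' hc hd' :=
  cellAt_comp m m' _ _ _ _

theorem pairCell_congr {x' : D.obj (op n)} {y' : E.obj (op n)} (hx : x = x') (hy : y = y') :
    pairCell m x y ha hb hc hd = pairCell m x' y' (hx ▸ ha) (hx ▸ hb) (hy ▸ hc) (hy ▸ hd) := by
  subst hx hy
  rfl

theorem eqToHom_conj_pairCell {a' b' : D.obj (op point)} {c' d' : E.obj (op point)} (ha' : a' = a)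
    (hb' : b = b') (hc' : c' = c) (hd' : d = d') :
    eqToHom (congrArg (incl (prodDiagram D E)).obj (Prod.ext ha' hc' : (a', c') = (a, c))) ≫
      pairCell m x y ha hb hc hd ≫
        eqToHom (congrArg (incl (prodDiagram D E)).obj (Prod.ext hb' hd' : (b, d) = (b', d'))) =
      pairCell m x y (ha.trans ha'.symm) (hb.trans hb') (hc.trans hc'.symm) (hd.trans hd') := by
  subst ha' hb' hc' hd'
  simp

theorem pairCell_naturality {x' : D.obj (op n)} {y' : E.obj (op n)} (g : x ⟶ x') (h : y ⟶ y')
    {a' b' : D.obj (op point)} {c' d' : E.obj (op point)}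
    (ha' : (atVertex D i).obj x' = a') (hb' : (atVertex D j).obj x' = b')
    (hc' : (atVertex E i).obj y' = c') (hd' : (atVertex E j).obj y' = d')
    (p : a ⟶ a') (q : b ⟶ b') (r : c ⟶ c') (s : d ⟶ d')
    (hp : (atVertex D i).map g = eqToHom ha ≫ p ≫ eqToHom ha'.symm)
    (hq : (atVertex D j).map g = eqToHom hb ≫ q ≫ eqToHom hb'.symm)
    (hr : (atVertex E i).map h = eqToHom hc ≫ r ≫ eqToHom hc'.symm)
    (hs : (atVertex E j).map h = eqToHom hd ≫ s ≫ eqToHom hd'.symm) :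
    (incl (prodDiagram D E)).map ((p, r) : (a, c) ⟶ (a', c')) ≫ pairCell m x' y' ha' hb' hc' hd' =
      pairCell m x y ha hb hc hd ≫
        (incl (prodDiagram D E)).map ((q, s) : (b, d) ⟶ (b', d')) := by
  subst ha hb hc hd ha' hb' hc' hd'
  simp only [eqToHom_refl, Category.id_comp, Category.comp_id] at hp hq hr hs
  subst hp hq hr hs
  exact (cell (prodDiagram D E) m).naturality (X := (x, y)) (Y := (x', y')) (g, h)

end PairCell

theorem pairCell_map {k n : SimplexCategory.Truncated 2} (f : k ⟶ n)
    {i j : reflexiveLaxCodescentWeight.{u}.obj k} (m : i ⟶ j) (x : D.obj (op n)) (y : E.obj (op n))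
    {a b : D.obj (op point)} {c d : E.obj (op point)}
    (ha : (atVertex D ((reflexiveLaxCodescentWeight.map f).toFunctor.obj i)).obj x = a)
    (hb : (atVertex D ((reflexiveLaxCodescentWeight.map f).toFunctor.obj j)).obj x = b)
    (hc : (atVertex E ((reflexiveLaxCodescentWeight.map f).toFunctor.obj i)).obj y = c)
    (hd : (atVertex E ((reflexiveLaxCodescentWeight.map f).toFunctor.obj j)).obj y = d) :
    pairCell ((reflexiveLaxCodescentWeight.map f).toFunctor.map m) x y ha hb hc hd =
      pairCell m ((D.map f.op).toFunctor.obj x) ((E.map f.op).toFunctor.obj y)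
        ((atVertex_map_obj D f i x).symm.trans ha) ((atVertex_map_obj D f j x).symm.trans hb)
        ((atVertex_map_obj E f i y).symm.trans hc) ((atVertex_map_obj E f j y).symm.trans hd) :=
  cellAt_map f m _ _ _

variable (D) in
/-- The cocone defining `left`. -/
abbrev leftCocone (e : E.obj (op point)) : Cocone D (Codescent (prodDiagram D E)) where
  functor := CategoryTheory.Prod.sectL (D.obj (op point)) e ⋙ incl (prodDiagram D E)
  -- The simplex `x` of `D` is paired with the constant simplex at `e`, all of whose vertices are
  -- `e`.
  cell {n i j} m x := pairCell m x ((degenerate E n).obj e) rfl rfl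
    (atVertex_degenerate i e) (atVertex_degenerate j e)
  cell_naturality {n i j} m x y g :=
    pairCell_naturality m _ _ _ _ _ _ g (𝟙 _) _ _ _ _ _ _ (𝟙 e) (𝟙 e)
      (by simp) (by simp) (by simp) (by simp)
  cell_id i x := pairCell_id _ _ _ _ _ _
  cell_comp m m' x := (pairCell_comp _ _ _ _ _ _ _ _ _ _).symm
  cell_map {k n} f {i j} m x :=
    (pairCell_map f m _ _ _ _ _ _).trans ((pairCell_congr m _ _ _ _ _ _ rfl
      (map_degenerate f e)).trans (eqToHom_conj_pairCell m _ _ _ _ _ _ (atVertex_map_obj D f i x)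
        (atVertex_map_obj D f j x).symm rfl rfl).symm)

variable (E) in
/-- The cocone defining `right`. -/
abbrev rightCocone (d : D.obj (op point)) : Cocone E (Codescent (prodDiagram D E)) where
  functor := CategoryTheory.Prod.sectR d (E.obj (op point)) ⋙ incl (prodDiagram D E)
  cell {n i j} m y := pairCell m ((degenerate D n).obj d) y (atVertex_degenerate i d)
    (atVertex_degenerate j d) rfl rfl
  cell_naturality {n i j} m x y g :=
    pairCell_naturality m _ _ _ _ _ _ (𝟙 _) g _ _ _ _ (𝟙 d) (𝟙 d) _ _
      (by simp) (by simp) (by simp) (by simp)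
  cell_id i x := pairCell_id _ _ _ _ _ _
  cell_comp m m' x := (pairCell_comp _ _ _ _ _ _ _ _ _ _).symm
  cell_map {k n} f {i j} m x :=
    (pairCell_map f m _ _ _ _ _ _).trans ((pairCell_congr m _ _ _ _ _ _
      (map_degenerate f d) rfl).trans (eqToHom_conj_pairCell m _ _ _ _ _ _ rfl rfl
        (atVertex_map_obj E f i x) (atVertex_map_obj E f j x).symm).symm)

end Codescent

end reflexiveLaxCodescentWeight

/-! ### Interchange of cells, by the two triangles of a square -/

namespace reflexiveLaxCodescentWeight

open CatWeight

variable {D E : (SimplexCategory.Truncated 2)ᵒᵖ ⥤ Cat.{u, u}}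

/-- The object `[1]`. -/
abbrev segment : SimplexCategory.Truncated 2 := ⟨SimplexCategory.mk 1, by simp⟩

/-- The object `[2]`. -/
abbrev triangle : SimplexCategory.Truncated 2 := ⟨SimplexCategory.mk 2, le_rfl⟩

instance {n : SimplexCategory.Truncated 2} (i j : reflexiveLaxCodescentWeight.{u}.obj n) :
    Subsingleton (i ⟶ j) :=
  inferInstanceAs (Subsingleton (ULift.{u} (@Quiver.Hom (Fin (n.obj.len + 1)) _ (ULift.down i) (ULift.down j))))

/-- An element of `[n]`, as an object of `W_l [n]`. -/
def elem {n : SimplexCategory.Truncated 2} (i : Fin (n.obj.len + 1)) :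
    reflexiveLaxCodescentWeight.{u}.obj n :=
  ULift.up i

/-- The morphism of `[n]` from a smaller element to a larger one. -/
def homOfLe {n : SimplexCategory.Truncated 2} (i j : Fin (n.obj.len + 1)) (h : i ≤ j) :
    elem.{u} i ⟶ elem.{u} j :=
  ULift.up (@homOfLE (Fin (n.obj.len + 1)) _ i j h)

/-- The nontrivial morphism of `[1]`. -/
abbrev step := homOfLe.{u} (n := segment) 0 1 (by simp)

/-- Every morphism of `[n]` is the image of the nontrivial one of `[1]`. -/
theorem exists_map_step {n : SimplexCategory.Truncated 2}
    {i j : reflexiveLaxCodescentWeight.{u}.obj n} (m : i ⟶ j) :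
    ∃ f : segment ⟶ n,
      (reflexiveLaxCodescentWeight.{u}.map f).toFunctor.obj (elem 0) = i ∧
        (reflexiveLaxCodescentWeight.{u}.map f).toFunctor.obj (elem 1) = j :=
  ⟨⟨SimplexCategory.mkOfLe (n := n.obj.len) (ULift.down i) (ULift.down j) (leOfHom (X := Fin (n.obj.len + 1)) (ULift.down m))⟩, rfl, rfl⟩

/-- The faces `[1] → [2]`. -/
abbrev face (i : Fin 3) : segment ⟶ triangle := ⟨SimplexCategory.δ i⟩

/-- The degeneracies `[2] → [1]`. -/
abbrev degeneracy (i : Fin 2) : triangle ⟶ segment := ⟨SimplexCategory.σ i⟩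

theorem face_zero_degeneracy_zero : face 0 ≫ degeneracy 0 = 𝟙 segment := by
  ext i
  fin_cases i <;> rfl

theorem face_one_degeneracy_zero : face 1 ≫ degeneracy 0 = 𝟙 segment := by
  ext i
  fin_cases i <;> rfl

theorem face_one_degeneracy_one : face 1 ≫ degeneracy 1 = 𝟙 segment := by
  ext i
  fin_cases i <;> rfl

theorem face_two_degeneracy_one : face 2 ≫ degeneracy 1 = 𝟙 segment := by
  ext i
  fin_cases i <;> rfl

/-- `σ₀` collapses the edge `01` to the vertex `0`; in the next lemma `σ₁` collapses `12` to the
vertex `1`. These edges supply the degenerate factors in the triangles. -/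
theorem face_two_degeneracy_zero : face 2 ≫ degeneracy 0 =
    default ≫ vertex.{u} (elem (n := segment) 0) := by
  ext i
  fin_cases i <;> rfl

theorem face_zero_degeneracy_one : face 0 ≫ degeneracy 1 =
    default ≫ vertex.{u} (elem (n := segment) 1) := by
  ext i
  fin_cases i <;> rfl

theorem map_map_of_comp_eq {k m n : SimplexCategory.Truncated 2} {f : k ⟶ m} {g : m ⟶ n}
    {h : k ⟶ n} (e : f ≫ g = h) (x : D.obj (op n)) :
    (D.map f.op).toFunctor.obj ((D.map g.op).toFunctor.obj x) = (D.map h.op).toFunctor.obj x := by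
  rw [← map_comp_obj, ← op_comp, e]

namespace Codescent

theorem pairCell_map' {k n : SimplexCategory.Truncated 2} (f : k ⟶ n)
    {i j : reflexiveLaxCodescentWeight.{u}.obj k} (m : i ⟶ j) (x : D.obj (op n)) (y : E.obj (op n))
    {x' : D.obj (op k)} {y' : E.obj (op k)}
    (hx : (D.map f.op).toFunctor.obj x = x') (hy : (E.map f.op).toFunctor.obj y = y')
    {a b : D.obj (op point)} {c d : E.obj (op point)}
    (ha : (atVertex D ((reflexiveLaxCodescentWeight.map f).toFunctor.obj i)).obj x = a)
    (hb : (atVertex D ((reflexiveLaxCodescentWeight.map f).toFunctor.obj j)).obj x = b)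
    (hc : (atVertex E ((reflexiveLaxCodescentWeight.map f).toFunctor.obj i)).obj y = c)
    (hd : (atVertex E ((reflexiveLaxCodescentWeight.map f).toFunctor.obj j)).obj y = d)
    (ha' : (atVertex D i).obj x' = a) (hb' : (atVertex D j).obj x' = b)
    (hc' : (atVertex E i).obj y' = c) (hd' : (atVertex E j).obj y' = d) :
    pairCell ((reflexiveLaxCodescentWeight.map f).toFunctor.map m) x y ha hb hc hd =
      pairCell m x' y' ha' hb' hc' hd' := by
  subst hx hy
  exact pairCell_map f m x y ha hb hc hd

/-- The diagonal of a square is one side followed by the other. The relation `cell_comp` at a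
2-simplex of the product says that its edge `02` is the edge `01` followed by `12`. -/
theorem pairCell_step_eq_left_comp_right (x : D.obj (op segment)) (y : E.obj (op segment))
    {a b : D.obj (op point)} {c d : E.obj (op point)}
    (ha : (atVertex D (elem (n := segment) 0)).obj x = a)
    (hb : (atVertex D (elem (n := segment) 1)).obj x = b)
    (hc : (atVertex E (elem (n := segment) 0)).obj y = c)
    (hd : (atVertex E (elem (n := segment) 1)).obj y = d) :
    pairCell step x ((degenerate E segment).obj c) ha hb (atVertex_degenerate _ c)
        (atVertex_degenerate _ c) ≫
      pairCell step ((degenerate D segment).obj b) y (atVertex_degenerate _ b)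
        (atVertex_degenerate _ b) hc hd = pairCell step x y ha hb hc hd := by
  -- The 2-simplex `(w, z) = (s₁ x, s₀ y)` has edge `01` equal to `x` paired with the constant at
  -- `c`, edge `12` equal to the constant at `b` paired with `y`, and edge `02` equal to `(x, y)`.
  let w := (D.map (degeneracy 1).op).toFunctor.obj x
  let z := (E.map (degeneracy 0).op).toFunctor.obj y
  have hw₁ : (D.map (face 1).op).toFunctor.obj w = x := by
    rw [map_map_of_comp_eq face_one_degeneracy_one, op_id, map_id_obj]
  have hz₁ : (E.map (face 1).op).toFunctor.obj z = y := by
    rw [map_map_of_comp_eq face_one_degeneracy_zero, op_id, map_id_obj]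
  have hw₂ : (D.map (face 2).op).toFunctor.obj w = x := by
    rw [map_map_of_comp_eq face_two_degeneracy_one, op_id, map_id_obj]
  have hz₂ : (E.map (face 2).op).toFunctor.obj z = (degenerate E segment).obj c := by
    rw [map_map_of_comp_eq face_two_degeneracy_zero.{u}, op_comp, map_comp_obj, hc]
  have hw₀ : (D.map (face 0).op).toFunctor.obj w = (degenerate D segment).obj b := by
    rw [map_map_of_comp_eq face_zero_degeneracy_one.{u}, op_comp, map_comp_obj, hb]
  have hz₀ : (E.map (face 0).op).toFunctor.obj z = y := by
    rw [map_map_of_comp_eq face_zero_degeneracy_zero, op_id, map_id_obj]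
  have ha' : (atVertex D (elem (n := triangle) 0)).obj w = a :=
    (atVertex_map_obj D (face 2) (elem 0) _).trans ((congrArg _ hw₂).trans ha)
  have hb' : (atVertex D (elem (n := triangle) 1)).obj w = b :=
    (atVertex_map_obj D (face 2) (elem 1) _).trans ((congrArg _ hw₂).trans hb)
  have hb'' : (atVertex D (elem (n := triangle) 2)).obj w = b :=
    (atVertex_map_obj D (face 1) (elem 1) _).trans ((congrArg _ hw₁).trans hb)
  have hc' : (atVertex E (elem (n := triangle) 0)).obj z = c :=
    (atVertex_map_obj E (face 1) (elem 0) _).trans ((congrArg _ hz₁).trans hc)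
  have hc'' : (atVertex E (elem (n := triangle) 1)).obj z = c :=
    (atVertex_map_obj E (face 0) (elem 0) _).trans ((congrArg _ hz₀).trans hc)
  have hd' : (atVertex E (elem (n := triangle) 2)).obj z = d :=
    (atVertex_map_obj E (face 0) (elem 1) _).trans ((congrArg _ hz₀).trans hd)
  have h₀₁ := pairCell_map' (face 2) step w z hw₂ hz₂ ha' hb' hc' hc'' ha hb
    (atVertex_degenerate _ c) (atVertex_degenerate _ c)
  have h₁₂ := pairCell_map' (face 0) step w z hw₀ hz₀ hb' hb'' hc'' hd' (atVertex_degenerate _ b)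
    (atVertex_degenerate _ b) hc hd
  have h₀₂ := pairCell_map' (face 1) step w z hw₁ hz₁ ha' hb'' hc' hd' ha hb hc hd
  rw [← h₀₁, ← h₁₂, ← h₀₂]
  exact pairCell_comp _ _ _ _ _ _ _ _ _ _

theorem pairCell_step_eq_right_comp_left (x : D.obj (op segment)) (y : E.obj (op segment))
    {a b : D.obj (op point)} {c d : E.obj (op point)}
    (ha : (atVertex D (elem (n := segment) 0)).obj x = a)
    (hb : (atVertex D (elem (n := segment) 1)).obj x = b)
    (hc : (atVertex E (elem (n := segment) 0)).obj y = c)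
    (hd : (atVertex E (elem (n := segment) 1)).obj y = d) :
    pairCell step ((degenerate D segment).obj a) y (atVertex_degenerate _ a)
        (atVertex_degenerate _ a) hc hd ≫
      pairCell step x ((degenerate E segment).obj d) ha hb (atVertex_degenerate _ d)
        (atVertex_degenerate _ d) = pairCell step x y ha hb hc hd := by
  -- The other triangle, `(s₀ x, s₁ y)`: it moves first along `y` and then along `x`.
  let w := (D.map (degeneracy 0).op).toFunctor.obj x
  let z := (E.map (degeneracy 1).op).toFunctor.obj y
  have hw₁ : (D.map (face 1).op).toFunctor.obj w = x := by
    rw [map_map_of_comp_eq face_one_degeneracy_zero, op_id, map_id_obj]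
  have hz₁ : (E.map (face 1).op).toFunctor.obj z = y := by
    rw [map_map_of_comp_eq face_one_degeneracy_one, op_id, map_id_obj]
  have hw₂ : (D.map (face 2).op).toFunctor.obj w = (degenerate D segment).obj a := by
    rw [map_map_of_comp_eq face_two_degeneracy_zero.{u}, op_comp, map_comp_obj, ha]
  have hz₂ : (E.map (face 2).op).toFunctor.obj z = y := by
    rw [map_map_of_comp_eq face_two_degeneracy_one, op_id, map_id_obj]
  have hw₀ : (D.map (face 0).op).toFunctor.obj w = x := by
    rw [map_map_of_comp_eq face_zero_degeneracy_zero, op_id, map_id_obj]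
  have hz₀ : (E.map (face 0).op).toFunctor.obj z = (degenerate E segment).obj d := by
    rw [map_map_of_comp_eq face_zero_degeneracy_one.{u}, op_comp, map_comp_obj, hd]
  have ha' : (atVertex D (elem (n := triangle) 0)).obj w = a :=
    (atVertex_map_obj D (face 1) (elem 0) _).trans ((congrArg _ hw₁).trans ha)
  have ha'' : (atVertex D (elem (n := triangle) 1)).obj w = a :=
    (atVertex_map_obj D (face 0) (elem 0) _).trans ((congrArg _ hw₀).trans ha)
  have hb' : (atVertex D (elem (n := triangle) 2)).obj w = b :=
    (atVertex_map_obj D (face 0) (elem 1) _).trans ((congrArg _ hw₀).trans hb)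
  have hc' : (atVertex E (elem (n := triangle) 0)).obj z = c :=
    (atVertex_map_obj E (face 2) (elem 0) _).trans ((congrArg _ hz₂).trans hc)
  have hd' : (atVertex E (elem (n := triangle) 1)).obj z = d :=
    (atVertex_map_obj E (face 2) (elem 1) _).trans ((congrArg _ hz₂).trans hd)
  have hd'' : (atVertex E (elem (n := triangle) 2)).obj z = d :=
    (atVertex_map_obj E (face 1) (elem 1) _).trans ((congrArg _ hz₁).trans hd)
  have h₀₁ := pairCell_map' (face 2) step w z hw₂ hz₂ ha' ha'' hc' hd' (atVertex_degenerate _ a)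
    (atVertex_degenerate _ a) hc hd
  have h₁₂ := pairCell_map' (face 0) step w z hw₀ hz₀ ha'' hb' hd' hd'' ha hb
    (atVertex_degenerate _ d) (atVertex_degenerate _ d)
  have h₀₂ := pairCell_map' (face 1) step w z hw₁ hz₁ ha' hb' hc' hd'' ha hb hc hd
  rw [← h₀₁, ← h₁₂, ← h₀₂]
  exact pairCell_comp _ _ _ _ _ _ _ _ _ _

/-- Components of the universal cocone at an arbitrary morphism reduce to those at `[1]`. -/
theorem pairCell_map_step {n : SimplexCategory.Truncated 2} (f : segment ⟶ n)
    {i j : reflexiveLaxCodescentWeight.{u}.obj n}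
    (hi : (reflexiveLaxCodescentWeight.{u}.map f).toFunctor.obj (elem 0) = i)
    (hj : (reflexiveLaxCodescentWeight.{u}.map f).toFunctor.obj (elem 1) = j) (m : i ⟶ j)
    (x : D.obj (op n)) (y : E.obj (op n)) {a b : D.obj (op point)} {c d : E.obj (op point)}
    (ha : (atVertex D i).obj x = a) (hb : (atVertex D j).obj x = b)
    (hc : (atVertex E i).obj y = c) (hd : (atVertex E j).obj y = d) {x' : D.obj (op segment)}
    {y' : E.obj (op segment)} (hx : (D.map f.op).toFunctor.obj x = x')
    (hy : (E.map f.op).toFunctor.obj y = y')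
    (ha' : (atVertex D (elem (n := segment) 0)).obj x' = a)
    (hb' : (atVertex D (elem (n := segment) 1)).obj x' = b)
    (hc' : (atVertex E (elem (n := segment) 0)).obj y' = c)
    (hd' : (atVertex E (elem (n := segment) 1)).obj y' = d) :
    pairCell m x y ha hb hc hd = pairCell step x' y' ha' hb' hc' hd' := by
  subst hi hj
  obtain rfl := Subsingleton.elim m ((reflexiveLaxCodescentWeight.map f).toFunctor.map step)
  exact pairCell_map' f step x y hx hy ha hb hc hd ha' hb' hc' hd'

theorem atVertex_map_obj_of_eq {k n : SimplexCategory.Truncated 2} (f : k ⟶ n)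
    {i : reflexiveLaxCodescentWeight.{u}.obj k} {j : reflexiveLaxCodescentWeight.{u}.obj n}
    (h : (reflexiveLaxCodescentWeight.map f).toFunctor.obj i = j) (x : D.obj (op n)) :
    (atVertex D i).obj ((D.map f.op).toFunctor.obj x) = (atVertex D j).obj x := by
  rw [← h, atVertex_map_obj]

variable (D) in
/-- The functor induced by a fixed object of the second codescent object. -/
abbrev left (e : E.obj (op point)) : Codescent D ⥤ Codescent (prodDiagram D E) :=
  (leftCocone D e).desc

variable (E) in
/-- The functor induced by a fixed object of the first codescent object. -/
abbrev right (d : D.obj (op point)) : Codescent E ⥤ Codescent (prodDiagram D E) :=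
  (rightCocone E d).desc

theorem left_map_cell (e : E.obj (op point)) {n : SimplexCategory.Truncated 2}
    {i j : reflexiveLaxCodescentWeight.{u}.obj n} (m : i ⟶ j) (x : D.obj (op n)) :
    (left D e).map ((cell D m).app x) = pairCell m x ((degenerate E n).obj e) rfl rfl
      (atVertex_degenerate i e) (atVertex_degenerate j e) :=
  (leftCocone D e).desc_map_cell m x

theorem right_map_cell (d : D.obj (op point)) {n : SimplexCategory.Truncated 2}
    {i j : reflexiveLaxCodescentWeight.{u}.obj n} (m : i ⟶ j) (y : E.obj (op n)) :
    (right E d).map ((cell E m).app y) = pairCell m ((degenerate D n).obj d) y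
      (atVertex_degenerate i d) (atVertex_degenerate j d) rfl rfl :=
  (rightCocone E d).desc_map_cell m y

/-- The dimensions `n` and `k` may differ, but both cells restrict to `[1]`, where each composite is
the diagonal cell. -/
theorem interchange_cell {n k : SimplexCategory.Truncated 2}
    {i j : reflexiveLaxCodescentWeight.{u}.obj n} (m : i ⟶ j) (x : D.obj (op n))
    {i' j' : reflexiveLaxCodescentWeight.{u}.obj k} (m' : i' ⟶ j') (y : E.obj (op k)) :
    (right E ((atVertex D i).obj x)).map ((cell E m').app y) ≫
        (left D ((atVertex E j').obj y)).map ((cell D m).app x) =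
      (left D ((atVertex E i').obj y)).map ((cell D m).app x) ≫
        (right E ((atVertex D j).obj x)).map ((cell E m').app y) := by
  obtain ⟨f, hi, hj⟩ := exists_map_step m
  obtain ⟨g, hi', hj'⟩ := exists_map_step m'
  have hl (e : E.obj (op point)) := (left_map_cell e m x).trans
    (pairCell_map_step f hi hj m x _ _ _ _ _ rfl (map_degenerate f e)
      (atVertex_map_obj_of_eq f hi x) (atVertex_map_obj_of_eq f hj x) (atVertex_degenerate _ e)
      (atVertex_degenerate _ e))
  have hr (d : D.obj (op point)) := (right_map_cell d m' y).trans
    (pairCell_map_step g hi' hj' m' _ y _ _ _ _ (map_degenerate g d) rfl (atVertex_degenerate _ d)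
      (atVertex_degenerate _ d) (atVertex_map_obj_of_eq g hi' y) (atVertex_map_obj_of_eq g hj' y))
  refine (congrArg₂ (· ≫ ·) (hr _) (hl _)).trans (.trans ?_
    (congrArg₂ (· ≫ ·) (hl _) (hr _)).symm)
  exact (pairCell_step_eq_right_comp_left _ _ _ _ _ _).trans
    (pairCell_step_eq_left_comp_right _ _ _ _ _ _).symm

/-- Shows that the cells of a product are composites of one-sided cells, so that `ofProd` recovers
them from their projections. -/
theorem pairCell_eq_left_comp_right {n : SimplexCategory.Truncated 2}
    {i j : reflexiveLaxCodescentWeight.{u}.obj n} (m : i ⟶ j) (x : D.obj (op n)) (y : E.obj (op n)) :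
    (left D ((atVertex E i).obj y)).map ((cell D m).app x) ≫
        (right E ((atVertex D j).obj x)).map ((cell E m).app y) =
      pairCell m x y rfl rfl rfl rfl := by
  obtain ⟨f, hi, hj⟩ := exists_map_step m
  have hl (e : E.obj (op point)) := (left_map_cell e m x).trans
    (pairCell_map_step f hi hj m x _ _ _ _ _ rfl (map_degenerate f e)
      (atVertex_map_obj_of_eq f hi x) (atVertex_map_obj_of_eq f hj x) (atVertex_degenerate _ e)
      (atVertex_degenerate _ e))
  have hr (d : D.obj (op point)) := (right_map_cell d m y).trans
    (pairCell_map_step f hi hj m _ y _ _ _ _ (map_degenerate f d) rfl (atVertex_degenerate _ d)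
      (atVertex_degenerate _ d) (atVertex_map_obj_of_eq f hi y) (atVertex_map_obj_of_eq f hj y))
  refine (congrArg₂ (· ≫ ·) (hl _) (hr _)).trans ?_
  refine (pairCell_step_eq_left_comp_right _ _ _ _ _ _).trans
    (pairCell_map_step f hi hj m x y _ _ _ _ rfl rfl _ _ _ _).symm

end Codescent

end reflexiveLaxCodescentWeight

/-! ### The inverse comparison functor and the preservation of finite products -/

namespace reflexiveLaxCodescentWeight

open CatWeight

variable {D E : (SimplexCategory.Truncated 2)ᵒᵖ ⥤ Cat.{u, u}}

namespace Codescent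

/-- Both paths are the image of `(f, g)` under `incl`. In the two mixed cases below, the square is
naturality of a cell along a morphism that is an identity in one factor and degenerate in the other.
-/
theorem interchange_mor_mor {x x' : D.obj (op point)} (f : x ⟶ x') {y y' : E.obj (op point)}
    (g : y ⟶ y') :
    CommSq ((right E x).map ((incl E).map g)) ((left D y).map ((incl D).map f))
      ((left D y').map ((incl D).map f)) ((right E x').map ((incl E).map g)) := by
  refine ⟨?_⟩
  refine ((incl (prodDiagram D E)).map_comp (X := (x, y)) (Y := (x, y')) (Z := (x', y')) (𝟙 x, g)
    (f, 𝟙 y')).symm.trans (.trans ?_ ((incl (prodDiagram D E)).map_comp (X := (x, y))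
      (Y := (x', y)) (Z := (x', y')) (f, 𝟙 y) (𝟙 x', g)))
  exact congrArg (fun h => (incl (prodDiagram D E)).map h)
    (Prod.ext ((Category.id_comp f).trans (Category.comp_id f).symm)
      ((Category.comp_id g).trans (Category.id_comp g).symm))

theorem interchange_cell_mor {n : SimplexCategory.Truncated 2}
    {i j : reflexiveLaxCodescentWeight.{u}.obj n} (m : i ⟶ j) (x : D.obj (op n))
    {y y' : E.obj (op point)} (g : y ⟶ y') :
    CommSq ((right E ((atVertex D i).obj x)).map ((incl E).map g))
      ((left D y).map ((cell D m).app x)) ((left D y').map ((cell D m).app x))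
      ((right E ((atVertex D j).obj x)).map ((incl E).map g)) := by
  refine ⟨(congrArg₂ (· ≫ ·) rfl (left_map_cell y' m x)).trans (.trans ?_
    (congrArg₂ (· ≫ ·) (left_map_cell y m x) rfl).symm)⟩
  exact pairCell_naturality m x _ _ _ _ _ (𝟙 x) ((degenerate E n).map g) _ _ _ _ (𝟙 _) (𝟙 _) g g
    (by simp) (by simp) (atVertex_degenerate_map i g) (atVertex_degenerate_map j g)

theorem interchange_mor_cell {x x' : D.obj (op point)} (f : x ⟶ x')
    {n : SimplexCategory.Truncated 2} {i j : reflexiveLaxCodescentWeight.{u}.obj n} (m : i ⟶ j)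
    (y : E.obj (op n)) :
    CommSq ((right E x).map ((cell E m).app y))
      ((left D ((atVertex E i).obj y)).map ((incl D).map f))
      ((left D ((atVertex E j).obj y)).map ((incl D).map f))
      ((right E x').map ((cell E m).app y)) := by
  refine ⟨(congrArg₂ (· ≫ ·) (right_map_cell x m y) rfl).trans (.trans ?_
    (congrArg₂ (· ≫ ·) rfl (right_map_cell x' m y)).symm)⟩
  exact (pairCell_naturality m _ y _ _ _ _ ((degenerate D n).map f) (𝟙 y) _ _ _ _ f f (𝟙 _) (𝟙 _)
    (atVertex_degenerate_map i f) (atVertex_degenerate_map j f) (by simp) (by simp)).symm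

/-- Commuting squares paste in both directions, so generators suffice. -/
theorem interchange {a a' : Codescent D} (f : a ⟶ a') {b b' : Codescent E} (g : b ⟶ b') :
    CommSq ((right E a.as).map g) ((left D b.as).map f) ((left D b'.as).map f)
      ((right E a'.as).map g) := by
  induction f using hom_induction with
  | mor f =>
    induction g using hom_induction with
    | mor g => exact interchange_mor_mor f g
    | cell m y => exact interchange_mor_cell f m y
    | comp g g' hg hg' =>
      rw [Functor.map_comp, Functor.map_comp]
      exact hg.horiz_comp hg'
  | cell m x =>
    induction g using hom_induction with
    | mor g => exact interchange_cell_mor m x g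
    | cell m' y => exact ⟨interchange_cell m x m' y⟩
    | comp g g' hg hg' =>
      rw [Functor.map_comp, Functor.map_comp]
      exact hg.horiz_comp hg'
  | comp f f' hf hf' =>
    rw [Functor.map_comp, Functor.map_comp]
    exact hf.vert_comp hf'

variable (D E) in
/-- The comparison from a product of codescent objects to the codescent object of the product. -/
abbrev ofProd : Codescent D × Codescent E ⥤ Codescent (prodDiagram D E) where
  obj a := ⟨(a.1.as, a.2.as)⟩
  map {a a'} f := (left D a.2.as).map f.1 ≫ (right E a'.1.as).map f.2
  map_id a := (congrArg₂ (· ≫ ·) ((left D a.2.as).map_id a.1) ((right E a.1.as).map_id a.2)).trans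
    (Category.id_comp _)
  map_comp {a a' a''} f g := by
    refine (congrArg₂ (· ≫ ·) ((left D a.2.as).map_comp f.1 g.1)
      ((right E a''.1.as).map_comp f.2 g.2)).trans ?_
    refine (Category.assoc _ _ _).trans (.trans ?_ (Category.assoc _ _ _).symm)
    refine congrArg (fun h => (left D a.2.as).map f.1 ≫ h) ?_
    refine (Category.assoc _ _ _).symm.trans (.trans ?_ (Category.assoc _ _ _))
    -- The middle factors `left g.1` and `right f.2` must change places.
    exact congrArg (fun h => h ≫ (right E a''.1.as).map g.2) (interchange g.1 f.2).w.symm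

variable (D E) in
theorem map_fst_prod'_map_snd_comp_ofProd :
    (map (fstDiagram D E)).prod' (map (sndDiagram D E)) ⋙ ofProd D E = 𝟭 _ := by
  refine functor_ext (fun _ => rfl) (fun {x y} f => ?_) fun m x => ?_
  · refine .trans ?_ ((Category.id_comp _).trans (Category.comp_id _)).symm
    refine ((incl (prodDiagram D E)).map_comp (X := (x.1, x.2)) (Y := (y.1, x.2))
      (Z := (y.1, y.2)) (f.1, 𝟙 x.2) (𝟙 y.1, f.2)).symm.trans ?_
    exact congrArg (fun h => (incl (prodDiagram D E)).map h)
      (Prod.ext (Category.comp_id _) (Category.id_comp _))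
  · refine .trans ?_ ((Category.id_comp _).trans (Category.comp_id _)).symm
    refine .trans ?_ (pairCell_eq_left_comp_right m x.1 x.2)
    exact congrArg₂ (fun p q => (left D ((atVertex E _).obj x.2)).map p ≫
      (right E ((atVertex D _).obj x.1)).map q) (Cocone.desc_map_cell _ m x)
        (Cocone.desc_map_cell _ m x)

theorem map_fst_pairCell {n : SimplexCategory.Truncated 2}
    {i j : reflexiveLaxCodescentWeight.{u}.obj n} (m : i ⟶ j) (x : D.obj (op n)) (y : E.obj (op n))
    {a b : D.obj (op point)} {c d : E.obj (op point)} (ha : (atVertex D i).obj x = a)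
    (hb : (atVertex D j).obj x = b) (hc : (atVertex E i).obj y = c)
    (hd : (atVertex E j).obj y = d) :
    (map (fstDiagram D E)).map (pairCell m x y ha hb hc hd) = cellAt D m x ha hb := by
  subst ha hb hc hd
  exact Cocone.desc_map_cell (mapCocone _ _ (fstDiagram D E)) m (x, y)

theorem map_snd_pairCell {n : SimplexCategory.Truncated 2}
    {i j : reflexiveLaxCodescentWeight.{u}.obj n} (m : i ⟶ j) (x : D.obj (op n)) (y : E.obj (op n))
    {a b : D.obj (op point)} {c d : E.obj (op point)} (ha : (atVertex D i).obj x = a)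
    (hb : (atVertex D j).obj x = b) (hc : (atVertex E i).obj y = c)
    (hd : (atVertex E j).obj y = d) :
    (map (sndDiagram D E)).map (pairCell m x y ha hb hc hd) = cellAt E m y hc hd := by
  subst ha hb hc hd
  exact Cocone.desc_map_cell (mapCocone _ _ (sndDiagram D E)) m (x, y)

/-- By `cellAt_map` along `[n] ⟶ [0]`, such a cell is indexed by a morphism of `[0]`, hence by an
identity. Consequently each projection annihilates the functor that varies only the other factor. -/
theorem cellAt_degenerate {n : SimplexCategory.Truncated 2}
    {i j : reflexiveLaxCodescentWeight.{u}.obj n} (m : i ⟶ j) (x : D.obj (op point)) :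
    cellAt D m ((degenerate D n).obj x) (atVertex_degenerate i x) (atVertex_degenerate j x) =
      𝟙 _ := by
  let F := (reflexiveLaxCodescentWeight.{u}.map (default : n ⟶ point)).toFunctor
  have hF : ∀ {k l : reflexiveLaxCodescentWeight.{u}.obj point} (p : k ⟶ l)
      (hk : (atVertex D k).obj x = x) (hl : (atVertex D l).obj x = x),
      cellAt D p x hk hl = 𝟙 _ := by
    intro k l p hk hl
    obtain rfl : k = l := congrArg ULift.up (Subsingleton.elim (α := Fin 1) _ _)
    obtain rfl := Subsingleton.elim p (𝟙 k)
    exact cellAt_id _ _ _ _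
  have h (k : reflexiveLaxCodescentWeight.{u}.obj point) : (atVertex D k).obj x = x := by
    rw [atVertex, Subsingleton.elim (vertex k) (𝟙 point), op_id, map_id_obj]
  exact (cellAt_map default m x (h (F.obj i)) (h (F.obj j))).symm.trans (hF _ _ _)

variable (D) in
theorem left_comp_map_fst (e : E.obj (op point)) :
    left D e ⋙ map (fstDiagram D E) = 𝟭 (Codescent D) := by
  refine functor_ext (fun _ => rfl) (fun {x y} f => ?_) fun m x => ?_
  · exact ((Category.id_comp _).trans (Category.comp_id _)).symm
  · refine .trans ?_ ((Category.id_comp _).trans (Category.comp_id _)).symm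
    exact (congrArg (fun p => (map (fstDiagram D E)).map p) (left_map_cell e m x)).trans
      (map_fst_pairCell m _ _ _ _ _ _)

variable (E) in
theorem right_comp_map_snd (d : D.obj (op point)) :
    right E d ⋙ map (sndDiagram D E) = 𝟭 (Codescent E) := by
  refine functor_ext (fun _ => rfl) (fun {x y} f => ?_) fun m x => ?_
  · exact ((Category.id_comp _).trans (Category.comp_id _)).symm
  · refine .trans ?_ ((Category.id_comp _).trans (Category.comp_id _)).symm
    exact (congrArg (fun p => (map (sndDiagram D E)).map p) (right_map_cell d m x)).trans
      (map_snd_pairCell m _ _ _ _ _ _)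

theorem map_snd_map_left_map (e : E.obj (op point)) {a b : Codescent D} (f : a ⟶ b) :
    (map (sndDiagram D E)).map ((left D e).map f) = 𝟙 ((incl E).obj e) := by
  induction f using hom_induction with
  | mor f => exact (incl E).map_id e
  | cell m x =>
    exact (congrArg (fun p => (map (sndDiagram D E)).map p) (left_map_cell e m x)).trans
      ((map_snd_pairCell m _ _ _ _ _ _).trans (cellAt_degenerate m e))
  | comp f g hf hg =>
    rw [Functor.map_comp, Functor.map_comp]
    exact (congrArg₂ (· ≫ ·) hf hg).trans (Category.id_comp _)

theorem map_fst_map_right_map (d : D.obj (op point)) {a b : Codescent E} (f : a ⟶ b) :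
    (map (fstDiagram D E)).map ((right E d).map f) = 𝟙 ((incl D).obj d) := by
  induction f using hom_induction with
  | mor f => exact (incl D).map_id d
  | cell m x =>
    exact (congrArg (fun p => (map (fstDiagram D E)).map p) (right_map_cell d m x)).trans
      ((map_fst_pairCell m _ _ _ _ _ _).trans (cellAt_degenerate m d))
  | comp f g hf hg =>
    rw [Functor.map_comp, Functor.map_comp]
    exact (congrArg₂ (· ≫ ·) hf hg).trans (Category.id_comp _)

variable (D E) in
theorem ofProd_comp_map_fst : ofProd D E ⋙ map (fstDiagram D E) = CategoryTheory.Prod.fst _ _ := by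
  refine CategoryTheory.Functor.ext (fun _ => rfl) fun a b f => ?_
  refine .trans ?_ ((Category.id_comp _).trans (Category.comp_id _)).symm
  refine ((map (fstDiagram D E)).map_comp _ _).trans ((congrArg₂ (· ≫ ·)
    ((Functor.congr_hom (left_comp_map_fst D a.2.as) f.1).trans
      ((Category.id_comp _).trans (Category.comp_id _)))
    (map_fst_map_right_map b.1.as f.2)).trans (Category.comp_id _))

variable (D E) in
theorem ofProd_comp_map_snd : ofProd D E ⋙ map (sndDiagram D E) = CategoryTheory.Prod.snd _ _ := by
  refine CategoryTheory.Functor.ext (fun _ => rfl) fun a b f => ?_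
  refine .trans ?_ ((Category.id_comp _).trans (Category.comp_id _)).symm
  refine ((map (sndDiagram D E)).map_comp _ _).trans ((congrArg₂ (· ≫ ·)
    (map_snd_map_left_map a.2.as f.1)
    ((Functor.congr_hom (right_comp_map_snd E b.1.as) f.2).trans
      ((Category.id_comp _).trans (Category.comp_id _)))).trans (Category.id_comp _))

end Codescent

variable (D E) in
/-- The codescent object functor preserves the binary product. -/
def isLimitMapProd : IsLimit (BinaryFan.mk (codescentFunctor.map (fstDiagram D E))
    (codescentFunctor.map (sndDiagram D E))) :=
  BinaryFan.isLimitMk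
    (fun s => ((s.fst.toFunctor.prod' s.snd.toFunctor) ⋙ Codescent.ofProd D E).toCatHom)
    (fun s => Cat.ext (congrArg (fun F => s.fst.toFunctor.prod' s.snd.toFunctor ⋙ F)
      (Codescent.ofProd_comp_map_fst D E)))
    (fun s => Cat.ext (congrArg (fun F => s.fst.toFunctor.prod' s.snd.toFunctor ⋙ F)
      (Codescent.ofProd_comp_map_snd D E)))
    fun s m hs ht => by
      -- With the projections of `m` substituted, uniqueness is the identity saying that `ofProd`
      -- reconstructs a morphism from its two projections.
      rw [← hs, ← ht]
      exact Cat.ext (congrArg (fun F => m.toFunctor ⋙ F)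
        (Codescent.map_fst_prod'_map_snd_comp_ofProd D E)).symm

instance : PreservesLimitsOfShape (Discrete WalkingPair) codescentFunctor.{u} where
  preservesLimit {K} :=
    have : PreservesLimit (pair (K.obj ⟨.left⟩) (K.obj ⟨.right⟩)) codescentFunctor.{u} :=
      preservesLimit_of_preserves_limit_cone (isLimitProdDiagram _ _)
        ((isLimitMapConeBinaryFanEquiv codescentFunctor _ _).symm (isLimitMapProd _ _))
    preservesLimit_of_iso_diagram codescentFunctor (diagramIsoPair K).symm

/-- The terminal diagram. -/
abbrev unitDiagram : (SimplexCategory.Truncated 2)ᵒᵖ ⥤ Cat.{u, u} :=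
  (Functor.const _).obj (Cat.of (Discrete PUnit.{u + 1}))

/-- `unitDiagram` is terminal. -/
def isTerminalUnitDiagram : IsTerminal unitDiagram.{u} :=
  IsTerminal.ofUniqueHom (fun D => { app := fun n => (Functor.star (D.obj n)).toCatHom })
    fun D t => NatTrans.ext (funext fun n => Cat.ext (Functor.punit_ext' _ _))

instance : Subsingleton (Codescent unitDiagram.{u}) :=
  ⟨fun _ _ => congrArg Codescent.mk (Subsingleton.elim (α := Discrete PUnit.{u + 1}) _ _)⟩

theorem hom_eq_eqToHom {a b : Codescent unitDiagram.{u}} (f : a ⟶ b) (h : a = b) :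
    f = eqToHom h := by
  induction f using Codescent.hom_induction with
  | @mor x y f =>
    obtain rfl := Subsingleton.elim (α := Discrete PUnit.{u + 1}) x y
    have hf : f = 𝟙 x := rfl
    exact (congrArg (fun k => (Codescent.incl unitDiagram).map k) hf).trans
      ((Codescent.incl unitDiagram).map_id x)
  -- The diagram is constant, so every simplex is degenerate.
  | cell m x => exact Codescent.cellAt_degenerate (D := unitDiagram) m x
  | comp f g hf hg =>
    rw [hf (Subsingleton.elim _ _), hg (Subsingleton.elim _ _), eqToHom_trans]

/-- The codescent object functor preserves the terminal object. -/
def isTerminalMapUnitDiagram : IsTerminal (codescentFunctor.obj unitDiagram.{u}) :=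
  IsTerminal.ofUniqueHom
    (fun C => ((Functor.const C).obj (⟨⟨PUnit.unit⟩⟩ : Codescent unitDiagram.{u})).toCatHom)
    fun _ _ => Cat.ext (CategoryTheory.Functor.ext
      (fun _ => Subsingleton.elim (α := Codescent unitDiagram.{u}) _ _) fun _ _ _ =>
        (hom_eq_eqToHom _ (Subsingleton.elim (α := Codescent unitDiagram.{u}) _ _)).trans
          (hom_eq_eqToHom _ _).symm)

instance : PreservesLimit (Functor.empty.{0} _) codescentFunctor.{u} :=
  preservesLimit_of_preserves_limit_cone isTerminalUnitDiagram
    ((isLimitMapConeEmptyConeEquiv codescentFunctor _).symm isTerminalMapUnitDiagram)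

instance : PreservesFiniteProducts codescentFunctor.{u} :=
  have := preservesLimitsOfShape_pempty_of_preservesTerminal codescentFunctor.{u}
  .of_preserves_binary_and_terminal _

/-- Reflexive lax codescent objects are sifted colimits. -/
theorem isSifted : IsSifted reflexiveLaxCodescentWeight.{u} :=
  ⟨codescentFunctor, ⟨weightedColimitFunctor⟩, inferInstance⟩

end reflexiveLaxCodescentWeight

end

theorem mainTheorem4 :
    CatWeight.IsSifted reflexiveLaxCodescentWeight.{u} ∧
      CatWeight.IsFlexible reflexiveLaxCodescentWeight.{u} := by
  exact ⟨reflexiveLaxCodescentWeight.isSifted, reflexiveLaxCodescentWeight.isFlexible⟩
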